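/- Let $(R,\mathfrak m,k)$ be a commutative noetherian local ring with $\mathfrak m^3=0$. Then $R$ is a Burch ring if and only if $$\beta_2^R(k) > (\operatorname{edim} R)^2 - r(R)$$ (an inequality of integers). Here $\beta_2^R(k)$ is the second Betti number of $k$, i.e. the rank of the second free module in the minimal free resolution of $k$ over $R$; $\operatorname{edim} R=\dim_k \mathfrak m/\mathfrak m^2$ is the embedding dimension; and $r(R)=\dim_k\operatorname{Ext}_R^{t}(k,R)$, with $t=\operatorname{depth}R$, is the (Cohen–Macaulay) type of $R$. An ideal $I$ of a local ring $(S,\mathfrak n)$ is called a Burch ideal if $\mathfrak n I\neq \mathfrak n(I:_S\mathfrak n)$. A noetherian local ring $R$ of depth $t$ with $\mathfrak m$-adic completion $\widehat R$ is called a Burch ring if there exist a maximal $\widehat R$-regular sequence $x_1,\dots,x_t$ in $\widehat R$, a regular local ring $S$ and a Burch ideal $I$ of $S$ such that $\widehat R/(x_1,\dots,x_t)\cong S/I$ as rings. -/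

import Mathlib

universe u

open IsLocalRing

/-- An ideal `I` of a local ring `(S, 𝔫)` is a Burch ideal if `𝔫 I ≠ 𝔫 (I :_S 𝔫)`. -/
def IsBurchIdeal {S : Type u} [CommRing S] [IsLocalRing S] (I : Ideal S) : Prop :=
  maximalIdeal S * I ≠ maximalIdeal S * I.colon (maximalIdeal S : Set S)

/-- The depth of a noetherian local ring: the largest length of a regular sequence on `R`.
(The condition `R ≠ (x₁, …, xₙ)R` in Mathlib's `IsRegular` forces all `xᵢ` to lie in the maximal
ideal; the set is bounded by the Krull dimension when `R` is noetherian local.) -/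
noncomputable def localDepth (R : Type u) [CommRing R] : ℕ :=
  sSup {n : ℕ | ∃ rs : List R, rs.length = n ∧ RingTheory.Sequence.IsRegular R rs}

/-- A noetherian local ring `(R, 𝔪)` of depth `t` is a Burch ring if there are a maximal regular
sequence `x₁, …, x_t` in the `𝔪`-adic completion `R̂`, a regular local ring `S` and a Burch ideal
`I` of `S` such that `R̂ / (x₁, …, x_t)` and `S / I` are isomorphic rings. -/
def IsBurchRing (R : Type u) [CommRing R] [IsLocalRing R] : Prop :=
  ∃ rs : List (AdicCompletion (maximalIdeal R) R),
    rs.length = localDepth R ∧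
    RingTheory.Sequence.IsRegular (AdicCompletion (maximalIdeal R) R) rs ∧
    (∀ y : AdicCompletion (maximalIdeal R) R,
      ¬ RingTheory.Sequence.IsRegular (AdicCompletion (maximalIdeal R) R) (rs ++ [y])) ∧
    ∃ (S : Type u) (_ : CommRing S) (_ : IsRegularLocalRing S) (I : Ideal S),
      IsBurchIdeal I ∧
      Nonempty ((AdicCompletion (maximalIdeal R) R ⧸ Ideal.ofList rs) ≃+* (S ⧸ I))

/-- The embedding dimension `dim_k 𝔪/𝔪²` of a noetherian local ring. -/
noncomputable def edim (R : Type u) [CommRing R] [IsLocalRing R] : ℕ :=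
  Module.finrank (ResidueField R) (CotangentSpace R)

/-- The (Cohen–Macaulay) type `dim_k Ext^t_R(k, R)` of a noetherian local ring of depth `t`.
The module `Ext^t_R(k, R)` is annihilated by `𝔪`, so its dimension over `k` is its length
over `R`. -/
noncomputable def cmType (R : Type u) [CommRing R] [IsLocalRing R] : ℕ :=
  (Module.length R (CategoryTheory.Abelian.Ext
    (ModuleCat.of R (ResidueField R)) (ModuleCat.of R R) (localDepth R))).toNat

/-- The minimal number of generators `μ_R(M)` of a finitely generated module. -/
noncomputable def numGens (R : Type u) [CommRing R] (M : Type u) [AddCommGroup M] [Module R M] :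
    ℕ :=
  (⊤ : Submodule R M).spanFinrank

theorem exists_minGens (R : Type u) [CommRing R] (M : Type u) [AddCommGroup M] [Module R M]
    [Module.Finite R M] :
    ∃ g : Fin (numGens R M) → M, Submodule.span R (Set.range g) = ⊤ := by
  obtain ⟨s, hs, hs'⟩ := Submodule.FG.exists_span_finset_card_eq_spanFinrank
    (Module.Finite.fg_top (R := R) (M := M))
  have e : Fin (numGens R M) ≃ s := (s.equivFinOfCardEq hs).symm
  exact ⟨fun i => (e i : M), by
    rw [show Set.range (fun i => (e i : M)) = (s : Set M) by
      ext x
      constructor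
      · rintro ⟨i, rfl⟩
        exact (e i).2
      · intro hx
        exact ⟨e.symm ⟨x, hx⟩, by simp⟩]
    exact hs'⟩

/-- A chosen minimal system of generators of a finitely generated module. -/
noncomputable def minGens (R : Type u) [CommRing R] (M : Type u) [AddCommGroup M] [Module R M]
    [Module.Finite R M] : Fin (numGens R M) → M :=
  (exists_minGens R M).choose

/-- The first syzygy `Ω M` of a finitely generated module over a noetherian local ring: the kernel
of the minimal free cover `R^{μ(M)} → M`. -/
noncomputable def syzygy (R : Type u) [CommRing R] (M : Type u) [AddCommGroup M] [Module R M]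
    [Module.Finite R M] : Submodule R (Fin (numGens R M) → R) :=
  LinearMap.ker (Fintype.linearCombination R (minGens R M))

/-- The `i`th Betti number of a finitely generated module over a noetherian local ring: the rank
`μ(Ωⁱ M)` of the `i`th free module in the minimal free resolution of `M`, which is obtained by
taking minimal free covers of the successive syzygies. -/
noncomputable def betti (R : Type u) [CommRing R] [IsNoetherianRing R] :
    ℕ → (M : Type u) → [AddCommGroup M] → [Module R M] → [Module.Finite R M] → ℕ
  | 0, M, _, _, _ => numGens R M
  | i + 1, M, _, _, _ => betti R i (syzygy R M)

/-! Let `F → 𝔪` be the minimal free cover, `K` its kernel and `e = edim R`. Lengths along `0 → K →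
𝔪F → 𝔪² → 0` give `β₂ + ℓ(𝔪K) + ℓ(𝔪²) = e² + ℓ(𝔪²F)` (`spanFinrank_ker_add_length`). Since `R` is
artinian, `r` is the length of the socle, so `β₂ - e² + r` is the sum of `ℓ(𝔪²F) - ℓ(𝔪K)` and `r -
ℓ(𝔪²)`. Both are nonnegative, so the inequality fails exactly when `𝔪K = 𝔪²F` and the socle is `𝔪²`
(`betti_two_gt_iff`).

Now let `R = S/I` with `𝔫` the maximal ideal of `S`. If both equalities hold, lifting them gives `𝔫³
⊆ 𝔫I` and `(I : 𝔫) ⊆ 𝔫² + I`, hence `𝔫(I : 𝔫) = 𝔫I` for every presentation (`not_isBurchIdeal_ker`).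
Conversely, let `S` be regular, `I ⊆ 𝔫²`, `𝔫 ≠ 0` and `𝔫(I : 𝔫) = 𝔫I`. A socle element outside `𝔪²`
would lift to a minimal generator of `𝔫` with square in `𝔫³`, which is impossible; and `𝔫³ ⊆ 𝔫I`
corrects a vector over `𝔫²` to a relation on the generators of `𝔫`, to which degree one Koszul
acyclicity applies (`isBurchIdeal_ker`).

A presentation with `I ⊆ 𝔫²` comes from Cohen's structure theorem in the case `𝔪³ = 0`
(`exists_regular_surjective`, `exists_surjective_ker_le_sq`). It is useless when `𝔫 = 0`, as a field
has no Burch ideal; then `R` is a field and `R⟦X⟧` serves instead. -/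

/-! ### Regular local rings: domains, quotients by minimal generators, Koszul relations -/

section RegularLocal

variable {S : Type u} [CommRing S]

theorem IsLocalRing.exists_fin_span_maximalIdeal [IsLocalRing S] [IsNoetherianRing S] :
    ∃ X : Fin (maximalIdeal S).spanFinrank → S, Ideal.span (Set.range X) = maximalIdeal S := by
  obtain ⟨s, hs, hs'⟩ := Submodule.FG.exists_span_finset_card_eq_spanFinrank
    (IsNoetherian.noetherian (maximalIdeal S))
  refine ⟨fun i => ((s.equivFinOfCardEq hs).symm i : S), ?_⟩
  rw [show (fun i => ((s.equivFinOfCardEq hs).symm i : S)) =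
    Subtype.val ∘ (s.equivFinOfCardEq hs).symm from rfl, Set.range_comp, Equiv.range_eq_univ]
  simpa using hs'

variable [IsLocalRing S] [IsNoetherianRing S] {d : ℕ} {X : Fin d → S}

theorem Ideal.exists_sum_eq_of_mem_span_image {R ι : Type*} [CommRing R] [Fintype ι] {X : ι → R}
    {s : Set ι} {x : R} (hx : x ∈ Ideal.span (X '' s)) :
    ∃ a : ι → R, (∀ i ∉ s, a i = 0) ∧ ∑ i, a i * X i = x := by
  classical
  induction hx using Submodule.span_induction with
  | mem x hx =>
    obtain ⟨i, hi, rfl⟩ := hx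
    refine ⟨Pi.single i 1, fun j hj => ?_, ?_⟩
    · exact Pi.single_eq_of_ne (by rintro rfl; exact hj hi) _
    · simp [Pi.single_apply]
  | zero => exact ⟨0, by simp, by simp⟩
  | add x y _ _ hx hy =>
    obtain ⟨a, ha, rfl⟩ := hx
    obtain ⟨b, hb, rfl⟩ := hy
    exact ⟨a + b, fun i hi => by simp [ha i hi, hb i hi],
      by simp [add_mul, Finset.sum_add_distrib]⟩
  | smul r x _ hx =>
    obtain ⟨a, ha, rfl⟩ := hx
    exact ⟨r • a, fun i hi => by simp [ha i hi], by simp [Finset.mul_sum, mul_assoc]⟩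

theorem Ideal.span_image_sup_span_image_compl {R ι : Type*} [CommRing R] (X : ι → R)
    (s : Set ι) : Ideal.span (X '' s) ⊔ Ideal.span (X '' sᶜ) = Ideal.span (Set.range X) := by
  rw [← Ideal.span_union, ← Set.image_union, Set.union_compl_self, Set.image_univ]

/-- Minimal generators of the maximal ideal are linearly independent modulo its square. -/
theorem IsLocalRing.mem_maximalIdeal_of_sum_mem_sq
    (hX : Ideal.span (Set.range X) = maximalIdeal S) (hd : d ≤ (maximalIdeal S).spanFinrank)
    {a : Fin d → S} (ha : ∑ i, a i * X i ∈ maximalIdeal S ^ 2) (i : Fin d) :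
    a i ∈ maximalIdeal S := by
  by_contra hi
  have hu : IsUnit (a i) := by simpa using hi
  have hmem : ∀ j, X j ∈ maximalIdeal S := fun j => hX ▸ Ideal.subset_span ⟨j, rfl⟩
  -- A unit coefficient makes `X i` redundant modulo `𝔫²`, so by Nakayama `d - 1` generators
  -- suffice.
  have key : Ideal.span (X '' {i}ᶜ) = maximalIdeal S := by
    apply le_antisymm
    · rw [Ideal.span_le]; rintro _ ⟨j, -, rfl⟩; exact hmem j
    · apply Submodule.le_of_le_smul_of_le_jacobson_bot (I := maximalIdeal S)
        (IsNoetherian.noetherian _) (IsLocalRing.jacobson_eq_maximalIdeal ⊥ bot_ne_top).ge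
      nth_rw 1 [← hX]
      rw [Ideal.span_le, smul_eq_mul, ← sq]
      rintro _ ⟨j, rfl⟩
      by_cases hj : j = i
      · subst hj
        have h1 : a j * X j = (∑ i, a i * X i) - ∑ i ∈ Finset.univ.erase j, a i * X i := by
          rw [← Finset.add_sum_erase _ _ (Finset.mem_univ j)]; ring
        have h2 : a j * X j ∈ Ideal.span (X '' {j}ᶜ) ⊔ maximalIdeal S ^ 2 := by
          rw [h1]
          refine sub_mem (Submodule.mem_sup_right ha) (Submodule.mem_sup_left ?_)
          refine sum_mem fun k hk => Ideal.mul_mem_left _ _ (Ideal.subset_span ⟨k, ?_, rfl⟩)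
          simpa using hk
        exact (Ideal.unit_mul_mem_iff_mem _ hu).1 h2
      · exact Submodule.mem_sup_left (Ideal.subset_span ⟨j, hj, rfl⟩)
  have h3 : (maximalIdeal S).spanFinrank ≤ (X '' {i}ᶜ).ncard := by
    rw [← key]
    exact Submodule.spanFinrank_span_le_ncard_of_finite (Set.toFinite _)
  have h4 : (X '' {i}ᶜ).ncard ≤ d - 1 := by
    refine (Set.ncard_image_le (Set.toFinite _)).trans ?_
    rw [Set.ncard_compl]; simp
  have := i.2
  omega

/-- Membership would express `q ∈ 𝔫²` with coefficient 1 at `X i`, against independence modulo `𝔫²`.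
The shift by `q` serves the socle step of `isBurchIdeal_ker`. -/
theorem IsLocalRing.notMem_span_image (hX : Ideal.span (Set.range X) = maximalIdeal S)
    (hd : d ≤ (maximalIdeal S).spanFinrank) {s : Set (Fin d)} {i : Fin d} (hi : i ∉ s)
    {q : S} (hq : q ∈ maximalIdeal S ^ 2) : X i - q ∉ Ideal.span (X '' s) := by
  classical
  intro h
  obtain ⟨a, ha, hsum⟩ := Ideal.exists_sum_eq_of_mem_span_image h
  have h1 : ∑ j, (Pi.single i 1 - a : Fin d → S) j * X j = q := by
    simp [sub_mul, Finset.sum_sub_distrib, hsum, Pi.single_apply]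
  have h2 := mem_maximalIdeal_of_sum_mem_sq hX hd (h1 ▸ hq) i
  rw [Pi.sub_apply, ha i hi, Pi.single_eq_same, sub_zero] at h2
  exact (Ideal.ne_top_iff_one _).1 (maximalIdeal.isMaximal S).ne_top h2

/-- An element of the maximal ideal outside its square belongs to a minimal system of
generators. -/
theorem IsLocalRing.exists_span_maximalIdeal_eq_of_notMem_sq
    {x : S} (hx : x ∈ maximalIdeal S) (hx' : x ∉ maximalIdeal S ^ 2) :
    ∃ X : Fin (maximalIdeal S).spanFinrank → S,
      Ideal.span (Set.range X) = maximalIdeal S ∧ ∃ i, X i = x := by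
  classical
  obtain ⟨X, hX⟩ := IsLocalRing.exists_fin_span_maximalIdeal (S := S)
  have hmem : ∀ j, X j ∈ maximalIdeal S := fun j => hX ▸ Ideal.subset_span ⟨j, rfl⟩
  obtain ⟨a, -, ha⟩ := Ideal.exists_sum_eq_of_mem_span_image (X := X) (s := Set.univ)
    (by rw [Set.image_univ, hX]; exact hx)
  obtain ⟨i, hi⟩ : ∃ i, a i ∉ maximalIdeal S := by
    by_contra! h
    refine hx' (ha ▸ sum_mem fun i _ => ?_)
    rw [sq]
    exact Ideal.mul_mem_mul (h i) (hmem i)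
  have hu : IsUnit (a i) := by simpa using hi
  refine ⟨Function.update X i x, le_antisymm ?_ ?_, i, by simp⟩
  · rw [Ideal.span_le]
    rintro _ ⟨j, rfl⟩
    by_cases hj : j = i
    · subst hj; simpa using hx
    · simpa [Function.update_of_ne hj] using hmem j
  · nth_rw 1 [← hX]
    rw [Ideal.span_le]
    have hne : ∀ j ≠ i, X j ∈ Ideal.span (Set.range (Function.update X i x)) := fun j hj =>
      Ideal.subset_span ⟨j, by simp [Function.update_of_ne hj]⟩
    rintro _ ⟨j, rfl⟩
    by_cases hj : j = i
    · subst hj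
      have h1 : a j * X j = x - ∑ i ∈ Finset.univ.erase j, a i * X i := by
        rw [← ha, ← Finset.add_sum_erase _ _ (Finset.mem_univ j)]; ring
      refine (Ideal.unit_mul_mem_iff_mem _ hu).1 (h1 ▸ sub_mem ?_ ?_)
      · exact Ideal.subset_span ⟨j, by simp⟩
      · exact sum_mem fun k hk => Ideal.mul_mem_left _ _ (hne k (Finset.ne_of_mem_erase hk))
    · exact hne j hj

end RegularLocal

/-- The generators outside `s` still generate the maximal ideal, while the dimension drops by at
most `s.ncard`; the two bounds meet. The inequality drives the inductions on `spanFinrank`. -/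
theorem IsRegularLocalRing.quotient_span_image {S : Type u} [CommRing S] [IsRegularLocalRing S]
    {d : ℕ} {X : Fin d → S} (hX : Ideal.span (Set.range X) = maximalIdeal S)
    (hd : d ≤ (maximalIdeal S).spanFinrank) (s : Set (Fin d)) :
    ∃ _ : IsRegularLocalRing (S ⧸ Ideal.span (X '' s)),
      (maximalIdeal (S ⧸ Ideal.span (X '' s))).spanFinrank + s.ncard ≤ d := by
  have hmem : ∀ j, X j ∈ maximalIdeal S := fun j => hX ▸ Ideal.subset_span ⟨j, rfl⟩
  have hle : Ideal.span (X '' s) ≤ maximalIdeal S := by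
    rw [Ideal.span_le]; rintro _ ⟨j, -, rfl⟩; exact hmem j
  have hnt : Nontrivial (S ⧸ Ideal.span (X '' s)) :=
    Ideal.Quotient.nontrivial_iff.2 (ne_top_of_le_ne_top (maximalIdeal.isMaximal S).ne_top hle)
  have hloc : IsLocalRing (S ⧸ Ideal.span (X '' s)) :=
    .of_surjective' (Ideal.Quotient.mk _) Ideal.Quotient.mk_surjective
  have hmap : maximalIdeal (S ⧸ Ideal.span (X '' s)) =
      Ideal.span (Ideal.Quotient.mk (Ideal.span (X '' s)) '' (X '' sᶜ)) := by
    rw [← IsLocalRing.map_maximalIdeal_of_surjective (Ideal.Quotient.mk (Ideal.span (X '' s)))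
      Ideal.Quotient.mk_surjective, ← hX, ← Ideal.span_image_sup_span_image_compl X s,
      Ideal.map_sup, Ideal.map_quotient_self, bot_sup_eq, Ideal.map_span]
  have hrk : (maximalIdeal (S ⧸ Ideal.span (X '' s))).spanFinrank ≤ sᶜ.ncard := by
    rw [hmap, ← Set.image_comp]
    exact (Submodule.spanFinrank_span_le_ncard_of_finite (Set.toFinite _)).trans
      (Set.ncard_image_le (Set.toFinite _))
  have hc := Set.ncard_add_ncard_compl s
  rw [Nat.card_fin] at hc
  refine ⟨IsRegularLocalRing.of_spanFinrank_maximalIdeal_le _ ?_, by omega⟩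
  have h1 := ringKrullDim_le_ringKrullDim_quotient_add_spanFinrank (Ideal.span (X '' s))
    (hle.trans (by rw [IsLocalRing.ringJacobson_eq_maximalIdeal]))
  have h2 : (Ideal.span (X '' s)).spanFinrank ≤ s.ncard :=
    (Submodule.spanFinrank_span_le_ncard_of_finite (Set.toFinite _)).trans
      (Set.ncard_image_le (Set.toFinite _))
  have := hloc
  have hfin := ringKrullDim_ne_top (R := S ⧸ Ideal.span (X '' s))
  have hbot := ringKrullDim_ne_bot (R := S ⧸ Ideal.span (X '' s))
  obtain ⟨n, hn⟩ : ∃ n : ℕ, ringKrullDim (S ⧸ Ideal.span (X '' s)) = n := by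
    generalize ringKrullDim (S ⧸ Ideal.span (X '' s)) = D at hfin hbot
    induction D with
    | bot => exact absurd rfl hbot
    | coe D =>
      induction D with
      | top => exact absurd rfl hfin
      | coe n => exact ⟨n, rfl⟩
  rw [← IsRegularLocalRing.spanFinrank_maximalIdeal, hn] at h1
  rw [hn]
  norm_cast at h1 ⊢
  omega

theorem IsRegularLocalRing.isField_of_spanFinrank_eq_zero {S : Type u} [CommRing S]
    [IsLocalRing S] [IsNoetherianRing S] (h : (maximalIdeal S).spanFinrank = 0) : IsField S := by
  rw [IsLocalRing.isField_iff_maximalIdeal_eq]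
  exact (Submodule.spanFinrank_eq_zero_iff_eq_bot (IsNoetherian.noetherian _)).1 h

theorem IsRegularLocalRing.quotient_span_singleton {S : Type u} [CommRing S]
    [IsRegularLocalRing S] {x : S} (hx : x ∈ maximalIdeal S) (hx' : x ∉ maximalIdeal S ^ 2) :
    ∃ _ : IsRegularLocalRing (S ⧸ Ideal.span {x}),
      (maximalIdeal (S ⧸ Ideal.span {x})).spanFinrank < (maximalIdeal S).spanFinrank := by
  obtain ⟨X, hX, i, rfl⟩ := IsLocalRing.exists_span_maximalIdeal_eq_of_notMem_sq hx hx'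
  have := IsRegularLocalRing.quotient_span_image hX le_rfl {i}
  rw [Set.image_singleton, Set.ncard_singleton] at this
  exact this

/-- A regular local ring is a domain. -/
theorem IsRegularLocalRing.isDomain_aux (n : ℕ) : ∀ (S : Type u) [CommRing S]
    [IsRegularLocalRing S], (maximalIdeal S).spanFinrank = n → IsDomain S := by
  induction n using Nat.strong_induction_on with
  | _ n ih =>
  intro S _ _ hn
  rcases Nat.eq_zero_or_pos n with h0 | hpos
  · exact (isField_of_spanFinrank_eq_zero (hn.trans h0)).isDomain
  have hdim : ringKrullDim S ≠ 0 := by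
    rw [← IsRegularLocalRing.spanFinrank_maximalIdeal, hn]
    exact_mod_cast hpos.ne'
  have hfin := minimalPrimes.finite_of_isNoetherianRing S
  -- Prime avoidance, which tolerates the non-prime member `𝔫²`.
  obtain ⟨x, hx, hx2, hxP⟩ : ∃ x ∈ maximalIdeal S, x ∉ maximalIdeal S ^ 2 ∧
      ∀ P ∈ minimalPrimes S, x ∉ P := by
    by_contra! h
    classical
    have hsub : (maximalIdeal S : Set S) ⊆
        ⋃ P ∈ ((insert (maximalIdeal S ^ 2) hfin.toFinset : Finset (Ideal S)) : Set (Ideal S)),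
          (P : Set S) := by
      intro x hx
      by_cases h2 : x ∈ maximalIdeal S ^ 2
      · exact Set.mem_biUnion (x := maximalIdeal S ^ 2) (by simp) h2
      · obtain ⟨P, hP, hxP⟩ := h x hx h2
        exact Set.mem_biUnion (x := P) (by simp [hP]) hxP
    have hprime : ∀ P ∈ insert (maximalIdeal S ^ 2) hfin.toFinset, P ≠ maximalIdeal S ^ 2 →
        P ≠ maximalIdeal S ^ 2 → (id P : Ideal S).IsPrime := by
      intro P hP hne _
      rw [Finset.mem_insert, or_iff_right hne, Set.Finite.mem_toFinset] at hP
      exact hP.1.1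
    · have hsub := (Ideal.subset_union_prime _ _ hprime).1 hsub
      obtain ⟨P, hP, hle⟩ := hsub
      rw [Finset.mem_insert] at hP
      rcases hP with rfl | hP
      · exact (not_lt_of_ge hle) (IsLocalRing.maximalIdeal_sq_lt_of_ringKrullDim_ne_zero hdim)
      · rw [Set.Finite.mem_toFinset] at hP
        have hprime : P.IsPrime := hP.1.1
        have : P = maximalIdeal S := le_antisymm (le_maximalIdeal hprime.ne_top) hle
        apply hdim
        rw [← IsLocalRing.maximalIdeal_height_eq_ringKrullDim, ← this,
          Ideal.height_eq_zero_iff.2 hP]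
        rfl
  obtain ⟨hreg, hlt⟩ := quotient_span_singleton hx hx2
  have hdom := ih _ (hn ▸ hlt) _ rfl
  have hprime : (Ideal.span {x}).IsPrime := (Ideal.Quotient.isDomain_iff_prime _).1 hdom
  -- A minimal prime `Q` inside the prime `(x)` does not contain `x`, so `Q = xQ` and `Q = 0` by
  -- Nakayama.
  obtain ⟨Q, hQ, hQx⟩ := Ideal.exists_minimalPrimes_le (I := ⊥) (J := Ideal.span {x}) bot_le
  have hQp : Q.IsPrime := hQ.1.1
  have hQ0 : Q = ⊥ := by
    apply Submodule.eq_bot_of_le_smul_of_le_jacobson_bot (maximalIdeal S) _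
      (IsNoetherian.noetherian _) _
      (IsLocalRing.jacobson_eq_maximalIdeal ⊥ bot_ne_top).ge
    intro q hq
    obtain ⟨s, rfl⟩ := Ideal.mem_span_singleton'.1 (hQx hq)
    rw [mul_comm]
    exact Ideal.mul_mem_mul hx ((hQp.mem_or_mem hq).resolve_right (hxP Q hQ))
  subst hQ0
  exact IsDomain.of_bot_isPrime S

instance (priority := low) IsRegularLocalRing.isDomain (S : Type u) [CommRing S]
    [IsRegularLocalRing S] : IsDomain S :=
  isDomain_aux _ S rfl

theorem IsRegularLocalRing.isPrime_span_image {S : Type u} [CommRing S] [IsRegularLocalRing S]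
    {d : ℕ} {X : Fin d → S} (hX : Ideal.span (Set.range X) = maximalIdeal S)
    (hd : d ≤ (maximalIdeal S).spanFinrank) (s : Set (Fin d)) :
    (Ideal.span (X '' s)).IsPrime := by
  obtain ⟨h, -⟩ := quotient_span_image hX hd s
  exact (Ideal.Quotient.isDomain_iff_prime _).1 inferInstance

/-- The degree one part of the acyclicity of the Koszul complex on minimal generators of the
maximal ideal of a regular local ring: a relation with coefficients in `𝔫²` is an
`𝔫`-combination of relations. -/
theorem IsRegularLocalRing.mem_smul_ker_linearCombination {S : Type u} [CommRing S]
    [IsRegularLocalRing S] {d : ℕ} {X : Fin d → S}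
    (hX : Ideal.span (Set.range X) = maximalIdeal S)
    (hd : d ≤ (maximalIdeal S).spanFinrank) {v : Fin d → S}
    (hv : ∀ i, v i ∈ maximalIdeal S ^ 2) (hv0 : Fintype.linearCombination S X v = 0) :
    v ∈ maximalIdeal S • LinearMap.ker (Fintype.linearCombination S X) := by
  classical
  have hmem : ∀ j, X j ∈ maximalIdeal S := fun j => hX ▸ Ideal.subset_span ⟨j, rfl⟩
  -- Induction on the number `n` of leading coordinates in which `v` may be nonzero.
  suffices H : ∀ (n : ℕ) (v : Fin d → S), (∀ i, v i ∈ maximalIdeal S ^ 2) →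
      (∀ i : Fin d, n ≤ i → v i = 0) → Fintype.linearCombination S X v = 0 →
      v ∈ maximalIdeal S • LinearMap.ker (Fintype.linearCombination S X) from
    H d v hv (fun i hi => absurd i.2 (not_lt.2 hi)) hv0
  intro n
  induction n with
  | zero =>
    intro v _ h _
    rw [show v = 0 from funext fun i => h i (Nat.zero_le _)]
    exact zero_mem _
  | succ n ih =>
    intro v hv hvn hv0
    by_cases hnd : d ≤ n
    · exact ih v hv (fun i hi => absurd i.2 (not_lt.2 (hnd.trans hi))) hv0
    let j : Fin d := ⟨n, not_le.1 hnd⟩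
    -- The relation puts `v j * X j` in the ideal of the earlier generators, which is prime and
    -- misses `X j`.
    have hlast : v j ∈ Ideal.span (X '' {i | i < j}) := by
      have hprime := isPrime_span_image hX hd {i | i < j}
      refine (hprime.mem_or_mem (?_ : v j * X j ∈ _)).resolve_right ?_
      · have h1 : v j * X j = - ∑ i ∈ Finset.univ.erase j, v i * X i := by
          rw [Fintype.linearCombination_apply, ← Finset.add_sum_erase _ _ (Finset.mem_univ j)]
            at hv0
          exact eq_neg_of_add_eq_zero_left hv0
        rw [h1]
        refine neg_mem (sum_mem fun i hi => ?_)
        rcases lt_or_gt_of_ne (Finset.ne_of_mem_erase hi) with h | h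
        · exact Ideal.mul_mem_left _ _ (Ideal.subset_span ⟨i, h, rfl⟩)
        · rw [hvn i h, zero_mul]; exact zero_mem _
      · have := IsLocalRing.notMem_span_image hX hd (s := {i | i < j}) (i := j)
          (lt_irrefl j) (zero_mem _)
        rwa [sub_zero] at this
    obtain ⟨a, ha0, ha⟩ := Ideal.exists_sum_eq_of_mem_span_image hlast
    have hamem := IsLocalRing.mem_maximalIdeal_of_sum_mem_sq hX hd (ha ▸ hv j)
    -- A combination of Koszul relations with coefficients in `𝔫`, because `v j ∈ 𝔫²`. Adding it
    -- kills coordinate `j` and keeps all entries in `𝔫²`.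
    let w : Fin d → S := ∑ i, a i • (Pi.single i (X j) - Pi.single j (X i))
    have hw : w ∈ maximalIdeal S • LinearMap.ker (Fintype.linearCombination S X) := by
      refine sum_mem fun i _ => Submodule.smul_mem_smul (hamem i) ?_
      rw [LinearMap.mem_ker, map_sub, Fintype.linearCombination_apply_single,
        Fintype.linearCombination_apply_single, smul_eq_mul, smul_eq_mul, mul_comm, sub_self]
    have hwval : ∀ k, w k = a k * X j - if k = j then v j else 0 := by
      intro k
      have hj : ∑ i, a i * (Pi.single j (X i) : Fin d → S) k = if k = j then v j else 0 := by
        split_ifs with h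
        · subst h; simpa using ha
        · simp [Pi.single_eq_of_ne h]
      simp only [w, Finset.sum_apply, Pi.smul_apply, Pi.sub_apply, smul_eq_mul, mul_sub,
        Finset.sum_sub_distrib, hj]
      simp [Pi.single_apply]
    have hsum : v + w ∈ maximalIdeal S • LinearMap.ker (Fintype.linearCombination S X) := by
      apply ih
      · intro k
        rw [Pi.add_apply, hwval]
        refine add_mem (hv k) (sub_mem ?_ ?_)
        · rw [sq]; exact Ideal.mul_mem_mul (hamem k) (hmem j)
        · split_ifs
          · exact hv j
          · exact zero_mem _
      · intro k hk
        have hak : a k = 0 := ha0 k (by simpa [j, Fin.lt_def] using hk)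
        rw [Pi.add_apply, hwval, hak, zero_mul, zero_sub]
        split_ifs with h
        · subst h; simp
        · rw [hvn k (by have : (k : ℕ) ≠ n := fun h' => h (Fin.ext h')
                        omega)]; simp
      · rw [map_add, hv0, zero_add]
        exact Submodule.smul_le_right hw
    simpa using sub_mem hsum hw

/-- A quotient of a regular local ring is the quotient of a regular local ring by an ideal
contained in the square of the maximal ideal. -/
theorem IsRegularLocalRing.exists_surjective_ker_le_sq {R : Type u} [CommRing R] [Nontrivial R]
    (n : ℕ) : ∀ (S : Type u) [CommRing S] [IsRegularLocalRing S] (f : S →+* R),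
    Function.Surjective f → (maximalIdeal S).spanFinrank = n →
    ∃ (T : Type u) (_ : CommRing T) (_ : IsRegularLocalRing T) (g : T →+* R),
      Function.Surjective g ∧ RingHom.ker g ≤ maximalIdeal T ^ 2 := by
  induction n using Nat.strong_induction_on with
  | _ n ih =>
  intro S _ _ f hf hn
  by_cases h : RingHom.ker f ≤ maximalIdeal S ^ 2
  · exact ⟨S, ‹_›, ‹_›, f, hf, h⟩
  obtain ⟨x, hxI, hx⟩ := SetLike.not_le_iff_exists.1 h
  have hxn : x ∈ maximalIdeal S := le_maximalIdeal (RingHom.ker_ne_top f) hxI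
  obtain ⟨hreg, hlt⟩ := quotient_span_singleton hxn hx
  refine ih _ (hn ▸ hlt) _ (Ideal.Quotient.lift (Ideal.span {x}) f ?_) ?_ rfl
  · intro a ha
    obtain ⟨b, rfl⟩ := Ideal.mem_span_singleton'.1 ha
    rw [map_mul, hxI, mul_zero]
  · exact Ideal.Quotient.lift_surjective_of_surjective _ _ hf

/-! ### Sections and lifts along square-zero extensions in characteristic `p` -/

section CohenRing

open Polynomial in
/-- A square-zero extension of a field of characteristic `p` by a ring of characteristic `p`
splits. -/
theorem RingHom.exists_section_of_charP {E k : Type*} [CommRing E] [Field k] (p : ℕ)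
    [Fact p.Prime] [CharP E p] (φ : E →+* k) (hφ : Function.Surjective φ)
    (hsq : ∀ x y, φ x = 0 → φ y = 0 → x * y = 0) :
    ∃ s : k →+* E, ∀ a, φ (s a) = a := by
  have hp : p.Prime := Fact.out
  have : Nontrivial E := φ.domain_nontrivial
  have : CharP k p := by
    refine (CharP.charP_iff_prime_eq_zero hp).2 ?_
    rw [← map_natCast φ, CharP.cast_eq_zero, map_zero]
  -- Candidates for the image of a section. Containing all `p`-th powers makes the image in `k` a
  -- field, since `g⁻¹ = (g⁻¹)^p * g^(p-1)`, over which every element of `k` has its `p`-th power.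
  let P : Set (Subring E) := {G | (∀ x, x ^ p ∈ G) ∧ ∀ x ∈ G, φ x = 0 → x = 0}
  have hbase : (frobenius E p).range ∈ P := by
    refine ⟨fun x => ⟨x, frobenius_def ..⟩, ?_⟩
    rintro _ ⟨x, rfl⟩ hx
    rw [frobenius_def] at hx ⊢
    rw [map_pow] at hx
    have hx0 : φ x = 0 := pow_eq_zero_iff hp.ne_zero |>.1 hx
    obtain ⟨n, hn⟩ := Nat.exists_eq_add_of_le hp.two_le
    rw [hn, pow_add, sq, hsq x x hx0 hx0, zero_mul]
  obtain ⟨G, -, hG⟩ := zorn_le_nonempty₀ P (fun c hc hchain y hy => by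
    refine ⟨sSup c, ⟨fun x => ?_, fun x hx hx0 => ?_⟩, fun z hz => le_sSup hz⟩
    · exact (le_sSup hy : y ≤ sSup c) ((hc hy).1 x)
    · obtain ⟨z, hz, hxz⟩ := (Subring.mem_sSup_of_directedOn ⟨y, hy⟩ hchain.directedOn).1 hx
      exact (hc hz).2 x hxz hx0) _ hbase
  obtain ⟨⟨hGpow, hGinj⟩, hmax⟩ := hG
  let L : Subfield k :=
    { G.map φ with
      inv_mem' := by
        rintro _ ⟨g, hg, rfl⟩
        obtain ⟨z, hz⟩ := hφ (φ g)⁻¹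
        by_cases h0 : φ g = 0
        · exact ⟨0, G.zero_mem, by rw [h0]; simp⟩
        · refine ⟨z ^ p * g ^ (p - 1), mul_mem (hGpow z) (pow_mem hg _), ?_⟩
          rw [map_mul, map_pow, map_pow, hz]
          obtain ⟨n, rfl⟩ := Nat.exists_eq_succ_of_ne_zero hp.ne_zero
          rw [Nat.succ_sub_one, pow_succ, mul_right_comm, ← mul_pow, inv_mul_cancel₀ h0, one_pow,
            one_mul] }
  let ψ : G →+* L := (φ.comp G.subtype).codRestrict L fun g => ⟨g, g.2, rfl⟩
  have hψ : ∀ g : G, (ψ g : k) = φ g := fun g => rfl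
  have hψinj : Function.Injective ψ := by
    rw [injective_iff_map_eq_zero]
    intro g hg
    exact Subtype.ext (hGinj g g.2 (by rw [← hψ, hg]; rfl))
  have hsurj : ∀ b, b ∈ L := by
    intro b
    by_contra hb
    obtain ⟨x, rfl⟩ := hφ b
    let c : G := ⟨x ^ p, hGpow x⟩
    -- Over `L`, this `q` becomes the minimal polynomial of `φ x`. Elements of `G[x]` are
    -- represented in degree below `p`, so injectivity survives the adjunction of `x`.
    let q : G[X] := X ^ p - C c
    have hqm : q.Monic := monic_X_pow_sub_C c hp.ne_zero
    have hqx : q.eval₂ G.subtype x = 0 := by simp [q, c]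
    have hirr : Irreducible (X ^ p - C (ψ c) : L[X]) := by
      refine X_pow_sub_C_irreducible_of_prime hp fun β hβ => hb ?_
      have h1 : (β : k) ^ p = φ x ^ p := by
        rw [← map_pow]
        exact congrArg Subtype.val hβ
      have := frobenius_inj k p (h1 : frobenius k p β = frobenius k p (φ x))
      exact this ▸ β.2
    have hmin : minpoly L (φ x) = X ^ p - C (ψ c) := by
      refine (minpoly.eq_of_irreducible_of_monic hirr ?_
        (monic_X_pow_sub_C _ hp.ne_zero)).symm
      simp only [map_sub, map_pow, aeval_X, aeval_C]
      rw [← map_pow]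
      exact sub_self _
    have hG' : (eval₂RingHom G.subtype x).range ∈ P := by
      refine ⟨fun y => ⟨C ⟨y ^ p, hGpow y⟩, by simp⟩, ?_⟩
      rintro _ ⟨g, rfl⟩ hg
      rw [coe_eval₂RingHom] at hg ⊢
      have h1 : g.eval₂ G.subtype x = (g %ₘ q).eval₂ G.subtype x := by
        conv_lhs => rw [← modByMonic_add_div g q]
        rw [eval₂_add, eval₂_mul, hqx, zero_mul, add_zero]
      rw [h1] at hg ⊢
      have h2 : aeval (φ x) ((g %ₘ q).map ψ) = 0 := by
        rw [aeval_def, eval₂_map]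
        rw [hom_eval₂] at hg
        exact hg
      have h3 := minpoly.dvd L _ h2
      have h4 : (g %ₘ q).map ψ = 0 := by
        refine eq_zero_of_dvd_of_degree_lt h3 ?_
        rw [hmin, degree_X_pow_sub_C hp.pos]
        refine (degree_map_le ..).trans_lt ?_
        have := degree_modByMonic_lt g hqm
        rwa [degree_X_pow_sub_C hp.pos] at this
      rw [(Polynomial.map_eq_zero_iff hψinj).1 h4, eval₂_zero]
    have hle : G ≤ (eval₂RingHom G.subtype x).range := fun y hy => ⟨C ⟨y, hy⟩, by simp⟩
    exact hb ⟨x, hmax hG' hle ⟨X, by simp⟩, rfl⟩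
  have hbij : Function.Bijective (φ.comp G.subtype) := by
    refine ⟨?_, fun b => ?_⟩
    · rw [injective_iff_map_eq_zero]
      exact fun g hg => Subtype.ext (hGinj g g.2 hg)
    · obtain ⟨g, hg, rfl⟩ := hsurj b
      exact ⟨⟨g, hg⟩, rfl⟩
  exact ⟨G.subtype.comp (RingEquiv.ofBijective _ hbij).symm.toRingHom, fun a =>
    (RingEquiv.ofBijective _ hbij).apply_symm_apply a⟩

/-- Homomorphisms from a flat lift `V` of a field of characteristic `p` lift along square-zero
extensions by modules annihilated by `p`. -/
theorem RingHom.exists_lift_of_flat_of_charP {V k B C : Type*} [CommRing V] [Field k]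
    [CommRing B] [CommRing C] (p : ℕ) [Fact p.Prime] [CharP k p] (π : V →+* k)
    (hπ : Function.Surjective π) (hπp : ∀ x, π x = 0 → (p : V) ∣ x)
    (hreg : ∀ x : V, p * x = 0 → x = 0) (g : B →+* C) (hg : Function.Surjective g)
    (hsq : ∀ x y, g x = 0 → g y = 0 → x * y = 0) (hgp : ∀ x, g x = 0 → p * x = 0)
    (f : V →+* C) : ∃ f' : V →+* B, g.comp f' = f := by
  -- In the fibre product `E = V ×_C B`, a lift of `f` is a section of `E → V`. The extension `E/pE
  -- → k` is square-zero of characteristic `p`, hence splits; as `p` is regular on `V`, `E` embeds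
  -- in `V × E/pE`, and the section lifts to `E`.
  let E : Subring (V × B) := RingHom.eqLocus (f.comp (RingHom.fst V B)) (g.comp (RingHom.snd V B))
  have hE : ∀ e : E, f e.1.1 = g e.1.2 := fun e => e.2
  have hEsurj : ∀ v, ∃ e : E, e.1.1 = v := fun v => by
    obtain ⟨b, hb⟩ := hg (f v)
    exact ⟨⟨(v, b), hb.symm⟩, rfl⟩
  let I : Ideal E := Ideal.span {(p : E)}
  let φ : E ⧸ I →+* k := Ideal.Quotient.lift I ((π.comp (RingHom.fst V B)).comp E.subtype) (by
    intro a ha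
    obtain ⟨b, rfl⟩ := Ideal.mem_span_singleton'.1 ha
    simp)
  have hφ : ∀ e : E, φ (Ideal.Quotient.mk I e) = π e.1.1 := fun e => rfl
  have hφs : Function.Surjective φ := fun a => by
    obtain ⟨v, rfl⟩ := hπ a
    obtain ⟨e, rfl⟩ := hEsurj v
    exact ⟨Ideal.Quotient.mk I e, rfl⟩
  have hpI : ∀ e : E, Ideal.Quotient.mk I (p * e) = 0 := fun e =>
    Ideal.Quotient.eq_zero_iff_mem.2 (Ideal.mul_mem_right _ _ (Ideal.mem_span_singleton_self _))
  have hadj : ∀ (x : E ⧸ I) (v : V), φ x = π v → ∃ e : E, Ideal.Quotient.mk I e = x ∧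
      e.1.1 = v := by
    intro x v hx
    obtain ⟨e, rfl⟩ := Ideal.Quotient.mk_surjective x
    rw [hφ] at hx
    obtain ⟨w, hw⟩ := hπp (v - e.1.1) (by rw [map_sub, hx, sub_self])
    obtain ⟨ew, rfl⟩ := hEsurj w
    refine ⟨e + p * ew, by rw [map_add, hpI, add_zero], ?_⟩
    change e.1.1 + (p : V) * ew.1.1 = v
    rw [← hw]; ring
  have hp0 : ((p : ℕ) : E ⧸ I) = 0 := by simpa using hpI 1
  have : CharP (E ⧸ I) p := by
    have : Nontrivial (E ⧸ I) := φ.domain_nontrivial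
    exact (CharP.charP_iff_prime_eq_zero Fact.out).2 hp0
  obtain ⟨s, hs⟩ := RingHom.exists_section_of_charP p φ hφs (by
    intro x y hx hy
    obtain ⟨e, rfl, he⟩ := hadj x 0 (by rw [hx, map_zero])
    obtain ⟨e', rfl, he'⟩ := hadj y 0 (by rw [hy, map_zero])
    rw [← map_mul]
    have : e * e' = 0 := by
      refine Subtype.ext (Prod.ext ?_ ?_)
      · change e.1.1 * e'.1.1 = 0
        rw [he, zero_mul]
      · exact hsq _ _ (by rw [← hE, he, map_zero]) (by rw [← hE, he', map_zero])
    rw [this, map_zero])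
  let Φ : E →+* V × (E ⧸ I) :=
    ((RingHom.fst V B).comp E.subtype).prod (Ideal.Quotient.mk I)
  have hΦ : Function.Injective Φ := by
    rw [injective_iff_map_eq_zero]
    intro e he
    have h1 : e.1.1 = 0 := congrArg Prod.fst he
    have h2 : Ideal.Quotient.mk I e = 0 := congrArg Prod.snd he
    obtain ⟨e', rfl⟩ := Ideal.mem_span_singleton.1 (Ideal.Quotient.eq_zero_iff_mem.1 h2)
    have h3 : e'.1.1 = 0 := hreg _ h1
    refine Subtype.ext (Prod.ext h1 ?_)
    exact hgp _ (by rw [← hE, h3, map_zero])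
  let Ψ : V →+* Φ.range := ((RingHom.id V).prod (s.comp π)).codRestrict Φ.range (by
    intro v
    obtain ⟨e, he, he'⟩ := hadj (s (π v)) v (hs _)
    exact ⟨e, Prod.ext he' he⟩)
  let e := RingEquiv.ofBijective Φ.rangeRestrict
    ⟨fun a b h => hΦ (congrArg Subtype.val h), Φ.rangeRestrict_surjective⟩
  refine ⟨((RingHom.snd V B).comp E.subtype).comp (e.symm.toRingHom.comp Ψ), ?_⟩
  ext v
  have h1 : e (e.symm (Ψ v)) = Ψ v := e.apply_symm_apply _
  have h2 : (e.symm (Ψ v)).1.1 = v := congrArg (fun z => z.1.1) h1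
  change g (e.symm (Ψ v)).1.2 = f v
  rw [← hE, h2]

end CohenRing

/-! ### A flat lift of a field of characteristic `p` -/

section CohenRingExistence

open Polynomial in
/-- Over a valuation ring of an algebraically closed field, roots of the reduction of a monic
polynomial lift to roots. -/
theorem ValuationSubring.exists_root_lift {Ω : Type*} [Field Ω] [IsAlgClosed Ω]
    (O : ValuationSubring Ω) (n : ℕ) : ∀ (q : O[X]), q.Monic → q.natDegree = n →
    ∀ a : ResidueField O, (q.map (residue O)).eval a = 0 →
    ∃ α : O, residue O α = a ∧ q.eval α = 0 := by
  induction n with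
  | zero =>
    intro q hq hn a ha
    rw [hq.natDegree_eq_zero.1 hn] at ha
    simp at ha
  | succ n ih =>
    intro q hq hn a ha
    have hdeg : (q.map (algebraMap O Ω)).degree ≠ 0 := by
      rw [hq.degree_map, degree_eq_natDegree hq.ne_zero, hn]
      exact_mod_cast n.succ_ne_zero
    -- `O` is integrally closed, so `ρ` lies in `O`; either it reduces to `a` or its linear factor
    -- can be removed.
    obtain ⟨ρ, hρ⟩ := IsAlgClosed.exists_root _ hdeg
    rw [IsRoot.def, eval_map] at hρ
    obtain ⟨r, rfl⟩ := IsIntegrallyClosed.isIntegral_iff.1 (⟨q, hq, hρ⟩ : IsIntegral O ρ)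
    have hr : q.IsRoot r := by
      rw [eval₂_hom] at hρ
      exact (FaithfulSMul.algebraMap_injective O Ω) (by rw [hρ, map_zero])
    obtain ⟨q₁, rfl⟩ := dvd_iff_isRoot.2 hr
    have hq₁ : q₁.Monic := (monic_X_sub_C r).of_mul_monic_left hq
    rw [Polynomial.map_mul, eval_mul, mul_eq_zero] at ha
    rcases ha with ha | ha
    · refine ⟨r, ?_, hr⟩
      simp only [Polynomial.map_sub, map_X, map_C, eval_sub, eval_X, eval_C] at ha
      exact (sub_eq_zero.1 ha).symm
    · rw [(monic_X_sub_C r).natDegree_mul hq₁, natDegree_X_sub_C] at hn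
      obtain ⟨α, h1, h2⟩ := ih q₁ hq₁ (by omega) a ha
      exact ⟨α, h1, by rw [eval_mul, h2, mul_zero]⟩

/-- Every field `k` embeds into the residue field of a valuation ring of an algebraically closed
field of characteristic zero. -/
theorem exists_valuationSubring_residueField (k : Type u) [Field k] :
    ∃ (Ω : Type u) (_ : Field Ω) (_ : IsAlgClosed Ω) (_ : CharZero Ω) (O : ValuationSubring Ω),
      Nonempty (k →+* ResidueField O) := by
  -- A domain of characteristic zero mapping onto `k`. Its localization at the kernel is dominated
  -- by a valuation ring of `Ω`.
  let A := MvPolynomial k ℤ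
  let θ : A →+* k := MvPolynomial.eval₂Hom (Int.castRingHom k) id
  have hθ : Function.Surjective θ := fun a => ⟨MvPolynomial.X a, MvPolynomial.eval₂_X _ _ _⟩
  let P : Ideal A := RingHom.ker θ
  have hP : P.IsPrime := RingHom.ker_isPrime θ
  let Ω := AlgebraicClosure (FractionRing A)
  have hinj : Function.Injective (algebraMap A Ω) := by
    rw [IsScalarTower.algebraMap_eq A (FractionRing A) Ω]
    exact (algebraMap (FractionRing A) Ω).injective.comp (IsFractionRing.injective A _)
  have hchar : CharZero Ω := charZero_of_injective_algebraMap hinj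
  have hunit : ∀ y : P.primeCompl, IsUnit (algebraMap A Ω y) := fun y => by
    rw [isUnit_iff_ne_zero, Ne, map_eq_zero_iff _ hinj]
    intro h
    exact y.2 (h ▸ zero_mem P)
  let j : Localization.AtPrime P →+* Ω := IsLocalization.lift hunit
  obtain ⟨O, hle, hloc⟩ := (LocalSubring.range j).exists_le_valuationSubring
  let f : Localization.AtPrime P →+* O := (Subring.inclusion hle).comp j.rangeRestrict
  let g : A →+* O := f.comp (algebraMap A _)
  have hker : RingHom.ker θ ≤ RingHom.ker ((residue O).comp g) := by
    intro a ha
    rw [RingHom.mem_ker, RingHom.comp_apply, residue_eq_zero_iff, mem_maximalIdeal,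
      mem_nonunits_iff]
    intro hu
    have h1 : IsUnit (j.rangeRestrict (algebraMap A _ a)) := hloc.map_nonunit _ hu
    have h2 := (IsLocalHom.of_surjective j.rangeRestrict
      j.rangeRestrict_surjective).map_nonunit _ h1
    exact (IsLocalization.AtPrime.isUnit_to_map_iff (Localization.AtPrime P) P a).1 h2 ha
  exact ⟨Ω, inferInstance, inferInstance, hchar, O,
    ⟨RingHom.liftOfSurjective θ hθ ⟨(residue O).comp g, hker⟩⟩⟩

open Polynomial in
/-- A field `k` of characteristic `p` lifts to a local ring `V` flat over `ℤ` with maximal ideal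
`pV`. -/
theorem exists_flat_lift_of_charP (k : Type u) [Field k] (p : ℕ) [Fact p.Prime] [CharP k p] :
    ∃ (V : Type u) (_ : CommRing V) (π : V →+* k), Function.Surjective π ∧
      (∀ x, π x = 0 → (p : V) ∣ x) ∧ (∀ x : V, p * x = 0 → x = 0) ∧
      ∀ x, π x ≠ 0 → IsUnit x := by
  have hp : p.Prime := Fact.out
  obtain ⟨Ω, _, _, _, O, ⟨ι⟩⟩ := exists_valuationSubring_residueField k
  have : CharP (ResidueField O) p := (CharP.charP_iff_prime_eq_zero hp).2 (by
    rw [← map_natCast ι, CharP.cast_eq_zero, map_zero])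
  have hunitO : ∀ x : O, residue O x ≠ 0 → IsUnit x := fun x hx =>
    (residue_ne_zero_iff_isUnit x).1 hx
  -- Subrings `V` with residues in `k` whose elements of zero residue lie in `pV`. A maximal one is
  -- the lift; `ℤ` starts Zorn's lemma.
  let P : Set (Subring O) := {V | (∀ x ∈ V, residue O x = 0 → ∃ y ∈ V, x = p * y) ∧
    ∀ x ∈ V, residue O x ∈ ι.range}
  have hbase : (⊥ : Subring O) ∈ P := by
    refine ⟨fun x hx hx0 => ?_, fun x hx => ?_⟩
    · obtain ⟨n, rfl⟩ := Subring.mem_bot.1 hx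
      rw [map_intCast, CharP.intCast_eq_zero_iff _ p] at hx0
      obtain ⟨m, rfl⟩ := hx0
      exact ⟨m, Subring.mem_bot.2 ⟨m, rfl⟩, by push_cast; rfl⟩
    · obtain ⟨n, rfl⟩ := Subring.mem_bot.1 hx
      rw [map_intCast]
      exact intCast_mem _ n
  obtain ⟨V, -, hV⟩ := zorn_le_nonempty₀ P (fun c hc hchain y hy => by
    refine ⟨sSup c, ⟨fun x hx hx0 => ?_, fun x hx => ?_⟩, fun z hz => le_sSup hz⟩
    · obtain ⟨z, hz, hxz⟩ := (Subring.mem_sSup_of_directedOn ⟨y, hy⟩ hchain.directedOn).1 hx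
      obtain ⟨w, hw, rfl⟩ := (hc hz).1 x hxz hx0
      exact ⟨w, (le_sSup hz : z ≤ sSup c) hw, rfl⟩
    · obtain ⟨z, hz, hxz⟩ := (Subring.mem_sSup_of_directedOn ⟨y, hy⟩ hchain.directedOn).1 hx
      exact (hc hz).2 x hxz) _ hbase
  obtain ⟨⟨hVp, hVres⟩, hmax⟩ := hV
  have hVunit : ∀ x ∈ V, residue O x ≠ 0 → ∃ y ∈ V, x * y = 1 := by
    -- Inverting the elements of nonzero residue stays within `P`, so by maximality they are already
    -- units.
    let V' : Subring O :=
      { carrier := {z | ∃ s ∈ V, residue O s ≠ 0 ∧ s * z ∈ V}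
        one_mem' := ⟨1, one_mem _, by simp, by simp⟩
        zero_mem' := ⟨1, one_mem _, by simp, by simp⟩
        mul_mem' := by
          rintro a b ⟨s, hs, hs0, ha⟩ ⟨t, ht, ht0, hb⟩
          refine ⟨s * t, mul_mem hs ht, by simp [hs0, ht0], ?_⟩
          convert mul_mem ha hb using 1; ring
        add_mem' := by
          rintro a b ⟨s, hs, hs0, ha⟩ ⟨t, ht, ht0, hb⟩
          refine ⟨s * t, mul_mem hs ht, by simp [hs0, ht0], ?_⟩
          convert add_mem (mul_mem ha ht) (mul_mem hb hs) using 1; ring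
        neg_mem' := by
          rintro a ⟨s, hs, hs0, ha⟩
          exact ⟨s, hs, hs0, by simpa using neg_mem ha⟩ }
    have hV' : V' ∈ P := by
      refine ⟨?_, ?_⟩
      · rintro z ⟨s, hs, hs0, hz⟩ hz0
        obtain ⟨y, hy, hsy⟩ := hVp _ hz (by rw [map_mul, hz0, mul_zero])
        obtain ⟨u, hu⟩ := hunitO s hs0
        refine ⟨↑u⁻¹ * y, ⟨s, hs, hs0, ?_⟩, ?_⟩
        · rw [← hu, ← mul_assoc, Units.mul_inv, one_mul]; exact hy
        · rw [← hu] at hsy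
          rw [mul_left_comm, ← hsy, ← mul_assoc, Units.inv_mul, one_mul]
      · rintro z ⟨s, hs, hs0, hz⟩
        obtain ⟨a, ha⟩ := hVres s hs
        obtain ⟨b, hb⟩ := hVres _ hz
        refine ⟨a⁻¹ * b, ?_⟩
        rw [map_mul, map_inv₀, ha, hb, map_mul, ← mul_assoc, inv_mul_cancel₀ hs0, one_mul]
    intro x hx hx0
    obtain ⟨y, hxy⟩ := (hunitO x hx0).exists_right_inv
    refine ⟨y, hmax hV' (fun z hz => ⟨1, one_mem _, by simp, by simpa using hz⟩)
      ⟨x, hx, hx0, hxy ▸ one_mem V⟩, hxy⟩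
  have hsurj : ∀ b : k, ∃ v ∈ V, residue O v = ι b := by
    let L : Subfield (ResidueField O) :=
      { V.map (residue O) with
        inv_mem' := by
          rintro _ ⟨v, hv, rfl⟩
          by_cases h0 : residue O v = 0
          · exact ⟨0, V.zero_mem, by rw [h0]; simp⟩
          · obtain ⟨w, hw, hvw⟩ := hVunit v hv h0
            refine ⟨w, hw, eq_inv_of_mul_eq_one_right ?_⟩
            rw [← map_mul, hvw, map_one] }
    let ψ : V →+* L := ((residue O).comp V.subtype).codRestrict L fun g => ⟨g, g.2, rfl⟩
    have hψ : ∀ g : V, (ψ g : ResidueField O) = residue O g := fun g => rfl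
    have hψs : Function.Surjective ψ := by
      rintro ⟨_, v, hv, rfl⟩
      exact ⟨⟨v, hv⟩, rfl⟩
    intro b
    -- For `b` transcendental, `minpoly` is 0 by convention and `q = 0` with any lift `α` works. In
    -- both cases a polynomial vanishing at `b` is a multiple of `q` modulo `p`, so `V[α]` is in
    -- `P`.
    obtain ⟨q, α, hq, hα, hqα⟩ : ∃ (q : V[X]) (α : O), q.map ψ = minpoly L (ι b) ∧
        residue O α = ι b ∧ q.eval₂ V.subtype α = 0 := by
      by_cases hint : IsIntegral L (ι b)
      · have hlift : minpoly L (ι b) ∈ Polynomial.lifts ψ := by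
          obtain ⟨q, hq⟩ := Polynomial.map_surjective ψ hψs (minpoly L (ι b))
          exact (Polynomial.mem_lifts _).2 ⟨q, hq⟩
        obtain ⟨q, hq, -, hqm⟩ := lifts_and_degree_eq_and_monic hlift (minpoly.monic hint)
        obtain ⟨α, hα, hqα⟩ := O.exists_root_lift _ (q.map V.subtype) (hqm.map _) rfl (ι b) (by
          have := minpoly.aeval L (ι b)
          rw [← hq, aeval_def, eval₂_map] at this
          rw [Polynomial.map_map, eval_map]
          exact this)
        exact ⟨q, α, hq, hα, by rwa [eval_map] at hqα⟩
      · obtain ⟨α, hα⟩ := residue_surjective (ι b)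
        exact ⟨0, α, by rw [Polynomial.map_zero, minpoly.eq_zero hint], hα, by simp⟩
    have hV' : (eval₂RingHom V.subtype α).range ∈ P := by
      refine ⟨?_, ?_⟩
      · rintro _ ⟨g, rfl⟩ hg
        rw [coe_eval₂RingHom] at hg ⊢
        have h1 : aeval (ι b) (g.map ψ) = 0 := by
          rw [aeval_def, eval₂_map, ← hα]
          rw [hom_eval₂] at hg
          exact hg
        obtain ⟨h, hh⟩ := minpoly.dvd L _ h1
        obtain ⟨H, rfl⟩ := Polynomial.map_surjective ψ hψs h
        have h2 : (C (p : V)) ∣ g - q * H := by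
          rw [C_dvd_iff_dvd_coeff]
          intro i
          have h3 : ψ ((g - q * H).coeff i) = 0 := by
            rw [← coeff_map, Polynomial.map_sub, Polynomial.map_mul, hq, hh, sub_self, coeff_zero]
          obtain ⟨y, hy, hxy⟩ := hVp _ ((g - q * H).coeff i).2 (by rw [← hψ, h3]; rfl)
          exact ⟨⟨y, hy⟩, Subtype.ext (by simpa using hxy)⟩
        obtain ⟨G, hG⟩ := h2
        refine ⟨G.eval₂ V.subtype α, ⟨G, rfl⟩, ?_⟩
        rw [sub_eq_iff_eq_add.1 hG, eval₂_add, eval₂_mul, eval₂_mul, hqα, zero_mul, add_zero,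
          eval₂_C, map_natCast]
      · rintro _ ⟨g, rfl⟩
        rw [coe_eval₂RingHom, eval₂_eq_sum_range, map_sum]
        refine sum_mem fun i _ => ?_
        rw [map_mul, map_pow, hα]
        exact mul_mem (hVres _ (g.coeff i).2) (pow_mem (ι.mem_range_self b) i)
    have hle : V ≤ (eval₂RingHom V.subtype α).range := fun y hy => ⟨C ⟨y, hy⟩, by simp⟩
    exact ⟨α, hmax hV' hle ⟨X, by simp⟩, hα⟩
  let e : k ≃+* ι.range := RingEquiv.ofBijective ι.rangeRestrict
    ⟨fun a b h => ι.injective (congrArg Subtype.val h), ι.rangeRestrict_surjective⟩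
  let ρ : V →+* ι.range := ((residue O).comp V.subtype).codRestrict ι.range fun v => hVres v v.2
  let π : V →+* k := e.symm.toRingHom.comp ρ
  have hπ : ∀ v, ι (π v) = residue O v := fun v =>
    congrArg Subtype.val (e.apply_symm_apply (ρ v))
  refine ⟨V, inferInstance, π, fun b => ?_, fun x hx => ?_, fun x hx => ?_, fun x hx => ?_⟩
  · obtain ⟨v, hv, hvb⟩ := hsurj b
    exact ⟨⟨v, hv⟩, ι.injective ((hπ _).trans hvb)⟩
  · obtain ⟨y, hy, hxy⟩ := hVp x x.2 (by rw [← hπ, hx, map_zero])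
    exact ⟨⟨y, hy⟩, Subtype.ext (by simpa using hxy)⟩
  · have h0 : (p : Ω) * ((x : O) : Ω) = 0 := by
      have := congrArg (fun z : V => ((z : O) : Ω)) hx
      simpa using this
    have hp0 : (p : Ω) ≠ 0 := by exact_mod_cast hp.ne_zero
    exact Subtype.ext (Subtype.ext ((mul_eq_zero.1 h0).resolve_left hp0))
  · obtain ⟨y, hy, hxy⟩ := hVunit x x.2 (by rw [← hπ]; simpa using hx)
    exact IsUnit.of_mul_eq_one ⟨y, hy⟩ (Subtype.ext hxy)

end CohenRingExistence

/-! ### Presentation of `R` by a regular local ring -/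

section RegularPresentation

/-- The extension is algebraic over a purely transcendental one, hence separable over it in
characteristic zero. -/
theorem Algebra.FormallySmooth.of_field_of_charZero (K L : Type*) [Field K] [CharZero K] [Field L]
    [Algebra K L] : Algebra.FormallySmooth K L := by
  obtain ⟨s, hs⟩ := exists_isTranscendenceBasis K L
  have := hs.isAlgebraic_field
  exact .of_algebraicIndependent_of_isSeparable hs.1

/-- A local ring with nilpotent maximal ideal and residue field of characteristic zero has a
coefficient field. -/
theorem IsLocalRing.exists_coefficientField_of_charZero (R : Type u) [CommRing R] [IsLocalRing R]
    [CharZero (ResidueField R)] (hR : IsNilpotent (maximalIdeal R)) :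
    ∃ f : ResidueField R →+* R, ∀ a, residue R (f a) = a := by
  obtain ⟨inst⟩ : Nonempty (Algebra ℚ R) := by
    rw [EqualCharZero.nonempty_algebraRat_iff]
    intro I hI
    have hle := le_maximalIdeal hI
    refine ⟨fun a b hab => Nat.cast_injective (R := ResidueField R) ?_⟩
    have := congrArg (Ideal.Quotient.factor hle) hab
    rwa [map_natCast, map_natCast] at this
  have : Algebra.FormallySmooth ℚ (ResidueField R) := .of_field_of_charZero _ _
  let g : R →ₐ[ℚ] ResidueField R := (residue R).toRatAlgHom
  have hg : Function.Surjective g := residue_surjective (R := R)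
  have hnil : IsNilpotent (RingHom.ker (g : R →+* ResidueField R)) := by
    rw [show (g : R →+* ResidueField R) = residue R from rfl, ker_residue]
    exact hR
  let s := Algebra.FormallySmooth.liftOfSurjective (AlgHom.id ℚ (ResidueField R)) g hg hnil
  exact ⟨s, fun a => Algebra.FormallySmooth.liftOfSurjective_apply _ g hg hnil a⟩

/-- A local ring `V` whose maximal ideal is generated by a nonzerodivisor `p` maps onto a discrete
valuation ring through which all homomorphisms killing a power of `p` factor. -/
theorem exists_isDiscreteValuationRing_quotient {V k : Type u} [CommRing V] [Field k]
    (π : V →+* k) (p : V) (hπp : ∀ x, π x = 0 → p ∣ x) (hp0 : π p = 0)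
    (hreg : ∀ x : V, p * x = 0 → x = 0) (hunit : ∀ x, π x ≠ 0 → IsUnit x) :
    ∃ I : Ideal V, (∀ n, I ≤ Ideal.span {p ^ n}) ∧ ∃ _ : IsDomain (V ⧸ I),
      IsDiscreteValuationRing (V ⧸ I) := by
  have hnu : ¬ IsUnit p := fun h => (h.map π).ne_zero hp0
  -- `V` need not be `p`-adically separated. Modulo this intersection, every nonzero element is a
  -- unit times a power of `p`.
  let I : Ideal V := ⨅ n : ℕ, Ideal.span {p ^ n}
  have hI : ∀ x, x ∈ I ↔ ∀ n : ℕ, p ^ n ∣ x := by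
    simp [I, Ideal.mem_span_singleton]
  have hregn : ∀ (n : ℕ) x, p ^ n * x = 0 → x = 0 := by
    intro n
    induction n with
    | zero => simp
    | succ n ih => exact fun x hx => ih x (hreg _ (by rw [← hx]; ring))
  have hpn : ∀ n : ℕ, p ^ n ∉ I := by
    intro n hn
    obtain ⟨y, hy⟩ := (hI _).1 hn (n + 1)
    have : p ^ n * (1 - p * y) = 0 := by rw [mul_sub, mul_one]; nth_rw 1 [hy]; ring
    exact hnu (IsUnit.of_mul_eq_one y (sub_eq_zero.1 (hregn n _ this)).symm)
  have hfac : ∀ x ∉ I, ∃ (n : ℕ) (u : Vˣ), x = p ^ n * u := by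
    intro x hx
    rw [hI] at hx
    push Not at hx
    classical
    have h1 := Nat.find_spec hx
    have h2 : ∀ m < Nat.find hx, ¬ ¬ p ^ m ∣ x := fun m => Nat.find_min hx
    generalize Nat.find hx = n at h1 h2
    cases n with
    | zero => simp at h1
    | succ n =>
      have h3 := h2 n n.lt_succ_self
      rw [not_not] at h3
      obtain ⟨y, rfl⟩ := h3
      have hy : IsUnit y := by
        by_contra hy
        have : π y = 0 := by
          by_contra h; exact hy (hunit y h)
        obtain ⟨z, rfl⟩ := hπp y this
        exact h1 ⟨z, by ring⟩
      exact ⟨n, hy.unit, rfl⟩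
  have hprime : I.IsPrime := by
    refine ⟨fun h => hpn 0 (by rw [h]; trivial), fun {x y} hxy => ?_⟩
    by_contra! h
    obtain ⟨n, u, rfl⟩ := hfac x h.1
    obtain ⟨m, v, rfl⟩ := hfac y h.2
    apply hpn (n + m)
    have : p ^ (n + m) = (p ^ n * u * (p ^ m * v)) * ((u * v)⁻¹ : Vˣ) := by
      rw [show p ^ n * u * (p ^ m * v) = p ^ (n + m) * ((u * v : Vˣ) : V) by push_cast; ring,
        mul_assoc, Units.mul_inv, mul_one]
    rw [this]
    exact Ideal.mul_mem_right _ _ hxy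
  have hdom : IsDomain (V ⧸ I) := (Ideal.Quotient.isDomain_iff_prime I).2 hprime
  refine ⟨I, fun n => iInf_le _ n, hdom, ?_⟩
  have hfac' : ∀ x : V ⧸ I, x ≠ 0 →
      ∃ n : ℕ, Associated ((Ideal.Quotient.mk I p) ^ n) x := by
    intro x hx
    obtain ⟨x, rfl⟩ := Ideal.Quotient.mk_surjective x
    obtain ⟨n, u, rfl⟩ := hfac x (fun h => hx (Ideal.Quotient.eq_zero_iff_mem.2 h))
    exact ⟨n, Units.map (Ideal.Quotient.mk I) u, by simp⟩
  refine IsDiscreteValuationRing.ofHasUnitMulPowIrreducibleFactorization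
    ⟨Ideal.Quotient.mk I p, ?_, fun {x} hx => hfac' x hx⟩
  have hp0' : Ideal.Quotient.mk I p ≠ 0 := fun h =>
    hpn 1 (by rw [pow_one]; exact Ideal.Quotient.eq_zero_iff_mem.1 h)
  have hIp : ∀ x ∈ I, π x = 0 := fun x hx => by
    obtain ⟨y, rfl⟩ := (hI x).1 hx 1
    rw [map_mul, map_pow, hp0, pow_one, zero_mul]
  have hnu' : ¬ IsUnit (Ideal.Quotient.mk I p) := fun h => by
    have := h.map (Ideal.Quotient.lift I π hIp)
    rw [Ideal.Quotient.lift_mk, hp0] at this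
    exact not_isUnit_zero this
  refine ⟨hnu', fun {a b} hab => ?_⟩
  have ha : a ≠ 0 := by rintro rfl; exact hp0' (by rw [hab, zero_mul])
  have hb : b ≠ 0 := by rintro rfl; exact hp0' (by rw [hab, mul_zero])
  obtain ⟨n, u, hu⟩ := hfac' a ha
  obtain ⟨m, v, hv⟩ := hfac' b hb
  rcases Nat.eq_zero_or_pos n with rfl | hn
  · left; rw [← hu]; simp
  rcases Nat.eq_zero_or_pos m with rfl | hm
  · right; rw [← hv]; simp
  exfalso
  obtain ⟨n, rfl⟩ := Nat.exists_eq_succ_of_ne_zero hn.ne'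
  obtain ⟨m, rfl⟩ := Nat.exists_eq_succ_of_ne_zero hm.ne'
  apply hnu'
  refine IsUnit.of_mul_eq_one ((Ideal.Quotient.mk I p) ^ (n + m) * u * v) ?_
  apply mul_left_cancel₀ hp0'
  rw [mul_one]
  nth_rw 4 [hab]
  rw [← hu, ← hv, pow_succ, pow_succ]
  ring

/-- A local ring with `𝔪³ = 0` receives a homomorphism from a principal ideal domain which is
surjective on residue fields. -/
theorem IsLocalRing.exists_coefficientRing (R : Type u) [CommRing R] [IsLocalRing R]
    (hR : maximalIdeal R ^ 3 = ⊥) :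
    ∃ (W : Type u) (_ : CommRing W) (_ : IsDomain W) (_ : IsPrincipalIdealRing W) (f : W →+* R),
      ∀ a, ∃ w, residue R (f w) = a := by
  obtain ⟨p, hchar⟩ := CharP.exists (ResidueField R)
  rcases CharP.char_is_prime_or_zero (ResidueField R) p with hp | rfl
  swap
  · have := CharP.charP_to_charZero (ResidueField R)
    obtain ⟨f, hf⟩ := exists_coefficientField_of_charZero R ⟨3, hR⟩
    exact ⟨ResidueField R, inferInstance, inferInstance, inferInstance, f, fun a => ⟨a, hf a⟩⟩
  have : Fact p.Prime := ⟨hp⟩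
  have hpm : (p : R) ∈ maximalIdeal R := by
    rw [← residue_eq_zero_iff, map_natCast, CharP.cast_eq_zero]
  have hm3 : ∀ x y z : R, x ∈ maximalIdeal R → y ∈ maximalIdeal R → z ∈ maximalIdeal R →
      x * y * z = 0 := fun x y z hx hy hz => by
    rw [← Ideal.mem_bot, ← hR, pow_succ, sq]
    exact Ideal.mul_mem_mul (Ideal.mul_mem_mul hx hy) hz
  obtain ⟨V, _, π, hπ, hπp, hreg, hunit⟩ := exists_flat_lift_of_charP (ResidueField R) p
  have hp0 : π p = 0 := by rw [map_natCast, CharP.cast_eq_zero]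
  let m2 := maximalIdeal R ^ 2
  let g₁ : R ⧸ m2 →+* ResidueField R := Ideal.Quotient.factor (Ideal.pow_le_self two_ne_zero)
  have hg₁ : ∀ x : R, g₁ (Ideal.Quotient.mk m2 x) = residue R x := fun x => rfl
  have hker : ∀ x : R, g₁ (Ideal.Quotient.mk m2 x) = 0 → x ∈ maximalIdeal R := fun x hx =>
    (residue_eq_zero_iff x).1 hx
  -- Two square-zero steps, to `R/𝔪²` and then to `R`. Both kernels are killed by `p`, since `p ∈ 𝔪`
  -- and `𝔪³ = 0`.
  obtain ⟨f₁, hf₁⟩ := RingHom.exists_lift_of_flat_of_charP p π hπ hπp hreg g₁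
    (fun a => by
      obtain ⟨x, rfl⟩ := residue_surjective a
      exact ⟨Ideal.Quotient.mk m2 x, rfl⟩)
    (fun x y hx hy => by
      obtain ⟨x, rfl⟩ := Ideal.Quotient.mk_surjective x
      obtain ⟨y, rfl⟩ := Ideal.Quotient.mk_surjective y
      rw [← map_mul, Ideal.Quotient.eq_zero_iff_mem,
        show m2 = _ from sq _]
      exact Ideal.mul_mem_mul (hker x hx) (hker y hy))
    (fun x hx => by
      obtain ⟨x, rfl⟩ := Ideal.Quotient.mk_surjective x
      rw [← map_natCast (Ideal.Quotient.mk m2), ← map_mul, Ideal.Quotient.eq_zero_iff_mem,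
        show m2 = _ from sq _]
      exact Ideal.mul_mem_mul hpm (hker x hx)) π
  have hker2 : ∀ x : R, Ideal.Quotient.mk m2 x = 0 → x ∈ maximalIdeal R ^ 2 := fun x hx =>
    Ideal.Quotient.eq_zero_iff_mem.1 hx
  obtain ⟨f₂, hf₂⟩ := RingHom.exists_lift_of_flat_of_charP p π hπ hπp hreg (Ideal.Quotient.mk m2)
    Ideal.Quotient.mk_surjective
    (fun x y hx hy => by
      rw [← Ideal.mem_bot, ← hR, pow_succ]
      exact Ideal.mul_mem_mul (hker2 x hx) (Ideal.pow_le_self two_ne_zero (hker2 y hy)))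
    (fun x hx => by
      rw [← Ideal.mem_bot, ← hR, pow_succ']
      exact Ideal.mul_mem_mul hpm (hker2 x hx)) f₁
  have hres : ∀ v, residue R (f₂ v) = π v := fun v => by
    rw [← hg₁, ← hf₁]
    exact congrArg g₁ (RingHom.congr_fun hf₂ v)
  obtain ⟨I, hI, _, _⟩ := exists_isDiscreteValuationRing_quotient π p hπp hp0 hreg hunit
  refine ⟨V ⧸ I, inferInstance, inferInstance, inferInstance, Ideal.Quotient.lift I f₂ ?_, ?_⟩
  · intro x hx
    obtain ⟨y, rfl⟩ := Ideal.mem_span_singleton.1 (hI 3 hx)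
    rw [map_mul, map_pow, map_natCast, pow_succ, sq, hm3 _ _ _ hpm hpm hpm, zero_mul]
  · intro a
    obtain ⟨v, rfl⟩ := hπ a
    exact ⟨Ideal.Quotient.mk I v, hres v⟩

/-- A noetherian local ring with `𝔪³ = 0` is a quotient of a regular local ring. -/
theorem IsLocalRing.exists_regular_surjective (R : Type u) [CommRing R] [IsLocalRing R]
    [IsNoetherianRing R] (hR : maximalIdeal R ^ 3 = ⊥) :
    ∃ (S : Type u) (_ : CommRing S) (_ : IsRegularLocalRing S) (f : S →+* R),
      Function.Surjective f := by
  obtain ⟨W, _, _, _, f, hf⟩ := exists_coefficientRing R hR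
  obtain ⟨x, hx⟩ := exists_fin_span_maximalIdeal (S := R)
  let A := MvPolynomial (Fin (maximalIdeal R).spanFinrank) W
  let h : A →+* R := MvPolynomial.eval₂Hom f x
  -- Successive approximation: residues come from `W`, elements of `𝔪` from the variables. It is
  -- exact at `n = 3`.
  have happ : ∀ (n : ℕ) (r : R), ∃ a : A, r - h a ∈ maximalIdeal R ^ n := by
    intro n
    induction n with
    | zero => exact fun r => ⟨0, by simp⟩
    | succ n ih =>
      intro r
      obtain ⟨w, hw⟩ := hf (residue R r)
      have h1 : r - f w ∈ Ideal.span (x '' Set.univ) := by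
        rw [Set.image_univ, hx, ← residue_eq_zero_iff, map_sub, hw, sub_self]
      obtain ⟨c, -, hc⟩ := Ideal.exists_sum_eq_of_mem_span_image h1
      choose a ha using fun i => ih (c i)
      refine ⟨MvPolynomial.C w + ∑ i, a i * MvPolynomial.X i, ?_⟩
      have h2 : r - h (MvPolynomial.C w + ∑ i, a i * MvPolynomial.X i) =
          ∑ i, (c i - h (a i)) * x i := by
        have h3 : h (MvPolynomial.C w) = f w := MvPolynomial.eval₂_C _ _ _
        have h4 : ∀ i, h (MvPolynomial.X i) = x i := fun i => MvPolynomial.eval₂_X _ _ _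
        simp only [map_add, map_sum, map_mul, h3, h4, sub_mul, Finset.sum_sub_distrib, hc]
        ring
      rw [h2]
      refine sum_mem fun i _ => ?_
      rw [pow_succ]
      exact Ideal.mul_mem_mul (ha i) (hx ▸ Ideal.subset_span ⟨i, rfl⟩)
  have hsurj : Function.Surjective h := fun r => by
    obtain ⟨a, ha⟩ := happ 3 r
    rw [hR, Ideal.mem_bot, sub_eq_zero] at ha
    exact ⟨a, ha.symm⟩
  let P : Ideal A := (maximalIdeal R).comap h
  have hu : ∀ y : P.primeCompl, IsUnit (h y) := fun y => by
    have := y.2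
    simpa [P, Ideal.primeCompl] using this
  -- Polynomial rings over a principal ideal domain are regular.
  refine ⟨Localization.AtPrime P, inferInstance, inferInstance, IsLocalization.lift hu, fun r => ?_⟩
  obtain ⟨a, rfl⟩ := hsurj r
  exact ⟨algebraMap A _ a, IsLocalization.lift_eq hu a⟩

end RegularPresentation

/-! ### Lengths, type and the second Betti number -/

section Betti

theorem Module.length_eq_length_ker_add_length_range {R M N : Type*} [Ring R] [AddCommGroup M]
    [Module R M] [AddCommGroup N] [Module R N] (f : M →ₗ[R] N) :
    Module.length R M = Module.length R (LinearMap.ker f) + Module.length R (LinearMap.range f) :=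
  Module.length_eq_add_of_exact (LinearMap.ker f).subtype f.rangeRestrict
    (Submodule.subtype_injective _) f.surjective_rangeRestrict
    (by rw [LinearMap.exact_iff, LinearMap.ker_rangeRestrict, Submodule.range_subtype])

/-- For a finitely generated submodule `N` over a local ring, `ℓ(N) = ℓ(𝔪 N) + μ(N)`. -/
theorem IsLocalRing.length_eq_length_smul_add_spanFinrank {R M : Type*} [CommRing R]
    [IsLocalRing R] [AddCommGroup M] [Module R M] (N : Submodule R M) (hN : N.FG) :
    Module.length R N =
      Module.length R (maximalIdeal R • N : Submodule R M) + N.spanFinrank := by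
  have : Module.Finite R N := Module.Finite.iff_fg.2 hN
  let T : Submodule R N := maximalIdeal R • ⊤
  have h1 : Module.length R N = Module.length R T + Module.length R (N ⧸ T) :=
    Module.length_eq_add_of_exact T.subtype T.mkQ (Submodule.subtype_injective _)
      (Submodule.mkQ_surjective _) (by rw [LinearMap.exact_iff]; simp)
  have h2 : T.map N.subtype = maximalIdeal R • N := by
    rw [Submodule.map_smul'', Submodule.map_top, Submodule.range_subtype]
  have h3 : Module.length R T = Module.length R (maximalIdeal R • N : Submodule R M) := by
    rw [← h2]
    exact (Submodule.equivMapOfInjective N.subtype N.injective_subtype T).length_eq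
  have h4 : Module.length R (N ⧸ T) = N.spanFinrank := by
    rw [IsLocalRing.spanFinrank_eq_finrank_quotient N hN]
    let : Field (R ⧸ maximalIdeal R) := Ideal.Quotient.field _
    have : Module.Finite (R ⧸ maximalIdeal R) (N ⧸ T) :=
      Module.Finite.of_restrictScalars_finite R _ _
    rw [Module.length_eq_of_surjective (S := R) (R := R ⧸ maximalIdeal R)
      Ideal.Quotient.mk_surjective, Module.length_eq_finrank]
  rw [h1, h3, h4]

/-- The submodule `I F` of the free module `F = Rⁿ`. -/
def Ideal.piFin {R : Type*} [CommRing R] (I : Ideal R) (n : ℕ) : Submodule R (Fin n → R) :=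
  LinearMap.range (LinearMap.compLeft I.subtype (Fin n))

theorem Ideal.mem_piFin {R : Type*} [CommRing R] {I : Ideal R} {n : ℕ} {v : Fin n → R} :
    v ∈ I.piFin n ↔ ∀ i, v i ∈ I := by
  constructor
  · rintro ⟨w, rfl⟩ i
    exact (w i).2
  · exact fun h => ⟨fun i => ⟨v i, h i⟩, rfl⟩

theorem Ideal.length_piFin {R : Type*} [CommRing R] (I : Ideal R) (n : ℕ) :
    Module.length R (I.piFin n) = n * Module.length R I := by
  have hinj : Function.Injective (LinearMap.compLeft I.subtype (Fin n)) := fun v w h =>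
    funext fun i => Subtype.ext (congrFun h i)
  rw [piFin, ← (LinearEquiv.ofInjective _ hinj).length_eq, Module.length_pi]
  simp

/-- By minimality of `x` a relation has no unit coefficient. The second inclusion makes `ℓ(𝔪²F) -
ℓ(𝔪K)` nonnegative. -/
theorem IsLocalRing.smul_ker_le_piFin {R : Type u} [CommRing R] [IsLocalRing R]
    [IsNoetherianRing R] {n : ℕ} {x : Fin n → R}
    (hx : Ideal.span (Set.range x) = maximalIdeal R) (hn : n = (maximalIdeal R).spanFinrank) :
    LinearMap.ker (Fintype.linearCombination R x) ≤ (maximalIdeal R).piFin n ∧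
    maximalIdeal R • LinearMap.ker (Fintype.linearCombination R x) ≤
      (maximalIdeal R ^ 2).piFin n := by
  have h1 : LinearMap.ker (Fintype.linearCombination R x) ≤ (maximalIdeal R).piFin n := by
    intro v hv
    rw [Ideal.mem_piFin]
    refine mem_maximalIdeal_of_sum_mem_sq hx hn.le ?_
    rw [LinearMap.mem_ker, Fintype.linearCombination_apply] at hv
    change ∑ i, v i • x i ∈ _
    rw [hv]
    exact zero_mem _
  refine ⟨h1, Submodule.smul_le.2 fun r hr v hv => Ideal.mem_piFin.2 fun i => ?_⟩
  rw [sq]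
  exact Ideal.mul_mem_mul hr (Ideal.mem_piFin.1 (h1 hv) i)

/-- The count of lengths behind the theorem: `β₂ + ℓ(𝔪 K) + ℓ(𝔪²) = e² + ℓ(𝔪² F)`, where `K` is
the kernel of the minimal free cover `F → 𝔪`. -/
theorem IsLocalRing.spanFinrank_ker_add_length {R : Type u} [CommRing R] [IsLocalRing R]
    [IsArtinianRing R] {n : ℕ} {x : Fin n → R}
    (hx : Ideal.span (Set.range x) = maximalIdeal R) (hn : n = (maximalIdeal R).spanFinrank) :
    ((LinearMap.ker (Fintype.linearCombination R x)).spanFinrank : ℕ∞) +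
      Module.length R
        (maximalIdeal R • LinearMap.ker (Fintype.linearCombination R x) :
          Submodule R (Fin n → R)) +
      Module.length R ↥(maximalIdeal R ^ 2) =
    (n : ℕ∞) ^ 2 + Module.length R ((maximalIdeal R ^ 2).piFin n) := by
  set K := LinearMap.ker (Fintype.linearCombination R x) with hK
  have hKF := (smul_ker_le_piFin hx hn).1
  have h1 := length_eq_length_smul_add_spanFinrank K (IsNoetherian.noetherian _)
  have h2 := length_eq_length_smul_add_spanFinrank (maximalIdeal R) (IsNoetherian.noetherian _)
  rw [smul_eq_mul, ← sq, ← hn] at h2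
  -- The cover restricts to `𝔪F → 𝔪²`, still with kernel `K`.
  have h3 := Module.length_eq_length_ker_add_length_range
    ((Fintype.linearCombination R x).domRestrict ((maximalIdeal R).piFin n))
  have h4 : LinearMap.range
      ((Fintype.linearCombination R x).domRestrict ((maximalIdeal R).piFin n)) =
      maximalIdeal R ^ 2 := by
    rw [LinearMap.range_domRestrict]
    apply le_antisymm
    · rintro _ ⟨v, hv, rfl⟩
      rw [Fintype.linearCombination_apply, sq]
      exact sum_mem fun i _ => Ideal.mul_mem_mul (Ideal.mem_piFin.1 hv i)
        (hx ▸ Ideal.subset_span ⟨i, rfl⟩)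
    · rw [sq, Ideal.mul_le]
      intro r hr s hs
      rw [← hx, ← Set.image_univ] at hs
      obtain ⟨c, -, rfl⟩ := Ideal.exists_sum_eq_of_mem_span_image hs
      refine ⟨r • c, Ideal.mem_piFin.2 fun i => Ideal.mul_mem_right _ _ hr, ?_⟩
      rw [map_smul, Fintype.linearCombination_apply]
      rfl
  have h5 : Module.length R (LinearMap.ker
      ((Fintype.linearCombination R x).domRestrict ((maximalIdeal R).piFin n))) =
      Module.length R K := by
    rw [LinearMap.ker_domRestrict]
    exact (Submodule.submoduleOfEquivOfLe hKF).length_eq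
  rw [Ideal.length_piFin, h4, h5, h1, h2] at h3
  rw [Ideal.length_piFin, add_assoc, add_left_comm, ← add_assoc, ← h3]
  ring

theorem Submodule.length_strictMono {R M : Type*} [Ring R] [AddCommGroup M] [Module R M]
    [IsArtinian R M] [IsNoetherian R M] {A B : Submodule R M} (h : A < B) :
    Module.length R A < Module.length R B := by
  rw [Module.length_submodule, Module.length_submodule]
  exact Submodule.height_strictMono h

theorem localDepth_eq_zero (R : Type u) [CommRing R] [Nontrivial R] [IsArtinianRing R] :
    localDepth R = 0 := by
  have : {n : ℕ | ∃ rs : List R, rs.length = n ∧ RingTheory.Sequence.IsRegular R rs} = {0} := by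
    ext n
    constructor
    · rintro ⟨rs, rfl, h⟩
      rw [RingTheory.Sequence.eq_nil_of_isRegular_on_artinian h]
      rfl
    · rintro rfl
      exact ⟨[], rfl, .nil R R⟩
  rw [localDepth, this, csSup_singleton]

/-- In depth zero the type is the length of `Hom(k, R)`, and evaluation at 1 identifies this with
the socle. Finite length makes `toNat` harmless. -/
theorem cmType_eq_length_socle (R : Type u) [CommRing R] [IsLocalRing R] [IsArtinianRing R] :
    (cmType R : ℕ∞) =
      Module.length R ((⊥ : Ideal R).colon (maximalIdeal R : Set R)) := by
  have hmem : ∀ y, y ∈ (⊥ : Ideal R).colon (maximalIdeal R : Set R) ↔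
      ∀ a ∈ maximalIdeal R, y * a = 0 := fun y => by
    rw [Submodule.mem_colon]; rfl
  let g : (ResidueField R →ₗ[R] R) →ₗ[R] R := LinearMap.applyₗ 1
  have hg : ∀ φ, g φ = φ 1 := fun φ => rfl
  have hsmul : ∀ (φ : ResidueField R →ₗ[R] R) r, φ (residue R r) = r * φ 1 := fun φ r => by
    rw [← smul_eq_mul, ← map_smul, Algebra.smul_def, mul_one]
    rfl
  have hinj : Function.Injective g := fun φ ψ h => LinearMap.ext fun a => by
    obtain ⟨r, rfl⟩ := residue_surjective a
    rw [hsmul, hsmul, ← hg, h, hg]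
  have hrange : LinearMap.range g = (⊥ : Ideal R).colon (maximalIdeal R : Set R) := by
    ext y
    rw [hmem]
    constructor
    · rintro ⟨φ, rfl⟩ a ha
      rw [hg, mul_comm, ← hsmul, (residue_eq_zero_iff a).2 ha, map_zero]
    · intro hy
      have hle : maximalIdeal R ≤ LinearMap.ker (LinearMap.toSpanSingleton R R y) := fun a ha => by
        rw [LinearMap.mem_ker, LinearMap.toSpanSingleton_apply, smul_eq_mul, mul_comm, hy a ha]
      exact ⟨Submodule.liftQ (maximalIdeal R) (LinearMap.toSpanSingleton R R y) hle,
        one_mul y⟩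
  have e : CategoryTheory.Abelian.Ext (ModuleCat.of R (ResidueField R)) (ModuleCat.of R R) 0 ≃ₗ[R]
      (⊥ : Ideal R).colon (maximalIdeal R : Set R) :=
    (CategoryTheory.Abelian.Ext.linearEquiv₀ ≪≫ₗ ModuleCat.homLinearEquiv) ≪≫ₗ
      LinearEquiv.ofInjective g hinj ≪≫ₗ LinearEquiv.ofEq _ _ hrange
  rw [cmType, localDepth_eq_zero, e.length_eq]
  exact ENat.natCast_toNat Module.length_ne_top

/-- The first syzygy of `k` is a copy of `𝔪`, the chosen generator of `k` being nonzero. The `x` are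
existential because `betti` rests on chosen generators. -/
theorem betti_two_residueField (R : Type u) [CommRing R] [IsLocalRing R] [IsNoetherianRing R] :
    ∃ (n : ℕ) (x : Fin n → R), n = (maximalIdeal R).spanFinrank ∧
      Ideal.span (Set.range x) = maximalIdeal R ∧
      betti R 2 (ResidueField R) =
        (LinearMap.ker (Fintype.linearCombination R x)).spanFinrank := by
  have h1 : numGens R (ResidueField R) = 1 := by
    rw [numGens, show (⊤ : Submodule R (ResidueField R)) = Submodule.span R {1} from ?_]
    · exact Submodule.spanFinrank_singleton one_ne_zero
    · refine (eq_top_iff.2 fun a _ => ?_).symm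
      obtain ⟨r, rfl⟩ := residue_surjective a
      refine Submodule.mem_span_singleton.2 ⟨r, ?_⟩
      rw [Algebra.smul_def, mul_one]
      rfl
  have hu : Unique (Fin (numGens R (ResidueField R))) := (finCongr h1).unique
  let a : ResidueField R := minGens R (ResidueField R) default
  have ha : a ≠ 0 := by
    intro h
    have h2 : Submodule.span R (Set.range (minGens R (ResidueField R))) = ⊤ :=
      (exists_minGens R (ResidueField R)).choose_spec
    rw [Set.range_unique, show minGens R (ResidueField R) default = 0 from h,
      Submodule.span_zero_singleton] at h2
    exact bot_ne_top h2
  let M := syzygy R (ResidueField R)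
  let p : M →ₗ[R] R := (LinearMap.proj default).comp M.subtype
  have hp : Function.Injective p := fun v w h => Subtype.ext (funext fun i => by
    rw [Subsingleton.elim i default]; exact h)
  have hrange : LinearMap.range p = maximalIdeal R := by
    have hker : ∀ v : Fin (numGens R (ResidueField R)) → R,
        v ∈ M ↔ v default ∈ maximalIdeal R := fun v => by
      rw [show v ∈ M ↔ v default • a = 0 by
        simp [M, syzygy, Fintype.linearCombination_apply, a], Algebra.smul_def, mul_eq_zero,
        or_iff_left ha]
      exact residue_eq_zero_iff _
    ext r
    constructor
    · rintro ⟨v, rfl⟩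
      exact (hker v).1 v.2
    · exact fun hr => ⟨⟨fun _ => r, (hker _).2 hr⟩, rfl⟩
  have hgen : Submodule.span R (Set.range (minGens R M)) = ⊤ := (exists_minGens R M).choose_spec
  refine ⟨numGens R M, p ∘ minGens R M, ?_, ?_, ?_⟩
  · rw [numGens, ← Submodule.spanFinrank_map_eq_of_injective p hp, Submodule.map_top, hrange]
  · rw [Set.range_comp, Ideal.span, ← Submodule.map_span, hgen, Submodule.map_top, hrange]
  · have hK : syzygy R M = LinearMap.ker (Fintype.linearCombination R (p ∘ minGens R M)) := by
      ext v
      rw [syzygy, LinearMap.mem_ker, LinearMap.mem_ker, ← map_eq_zero_iff p hp]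
      simp [Fintype.linearCombination_apply]
    rw [← hK]
    exact Submodule.spanFinrank_top _

end Betti

/-! ### Burch ideals and the two defects -/

section Burch

theorem isArtinianRing_of_maximalIdeal_pow_eq_bot {R : Type u} [CommRing R] [IsLocalRing R]
    [IsNoetherianRing R] {n : ℕ} (hR : maximalIdeal R ^ n = ⊥) : IsArtinianRing R :=
  (isArtinianRing_iff_isNilpotent_maximalIdeal R).2 ⟨n, hR⟩

/-- The inequality says that two nonnegative defects have positive sum. Strict monotonicity of
finite length turns a zero defect into an equality of submodules. -/
theorem betti_two_gt_iff (R : Type u) [CommRing R] [IsLocalRing R] [IsNoetherianRing R]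
    (hR : maximalIdeal R ^ 3 = ⊥) : ∃ (n : ℕ) (x : Fin n → R),
      n = (maximalIdeal R).spanFinrank ∧ Ideal.span (Set.range x) = maximalIdeal R ∧
      ((betti R 2 (ResidueField R) : ℤ) > (edim R : ℤ) ^ 2 - (cmType R : ℤ) ↔
        ¬ ((maximalIdeal R ^ 2).piFin n ≤
            maximalIdeal R • LinearMap.ker (Fintype.linearCombination R x) ∧
          (⊥ : Ideal R).colon (maximalIdeal R : Set R) ≤ maximalIdeal R ^ 2)) := by
  have := isArtinianRing_of_maximalIdeal_pow_eq_bot hR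
  obtain ⟨n, x, hn, hx, hb⟩ := betti_two_residueField R
  refine ⟨n, x, hn, hx, ?_⟩
  have he : edim R = n := by
    rw [edim, ← spanFinrank_maximalIdeal_eq_finrank_cotangentSpace, hn]
  have hcount := spanFinrank_ker_add_length hx hn
  have hle := (smul_ker_le_piFin hx hn).2
  have hr := cmType_eq_length_socle R
  rw [hb, he]
  have hsoc : maximalIdeal R ^ 2 ≤ (⊥ : Ideal R).colon (maximalIdeal R : Set R) := by
    intro y hy
    rw [Submodule.mem_colon]
    intro a ha
    rw [← hR, pow_succ]
    exact Ideal.mul_mem_mul hy ha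
  set K := LinearMap.ker (Fintype.linearCombination R x)
  obtain ⟨a, ha⟩ := ENat.ne_top_iff_exists.1
    (Module.length_ne_top (R := R) (M := ↥(maximalIdeal R • K)))
  obtain ⟨b, hb'⟩ := ENat.ne_top_iff_exists.1
    (Module.length_ne_top (R := R) (M := ↥((maximalIdeal R ^ 2).piFin n)))
  obtain ⟨c, hc⟩ := ENat.ne_top_iff_exists.1
    (Module.length_ne_top (R := R) (M := ↥(maximalIdeal R ^ 2)))
  rw [← ha, ← hb', ← hc] at hcount
  have h1 : (maximalIdeal R ^ 2).piFin n ≤ maximalIdeal R • K ↔ a = b := by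
    constructor
    · intro h
      have := hle.antisymm h
      rw [← this, ← ha] at hb'
      exact_mod_cast hb'.symm
    · intro h
      by_contra h'
      have := Submodule.length_strictMono (lt_of_le_not_ge hle h')
      rw [← ha, ← hb', h] at this
      exact lt_irrefl _ this
  have h1' : a ≤ b := by
    have := Module.length_le_of_injective _ (Submodule.inclusion_injective hle)
    rw [← ha, ← hb'] at this
    exact_mod_cast this
  have h2 : (⊥ : Ideal R).colon (maximalIdeal R : Set R) ≤ maximalIdeal R ^ 2 ↔
      c = cmType R := by
    constructor
    · intro h
      rw [h.antisymm hsoc, ← hc] at hr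
      exact_mod_cast hr.symm
    · intro h
      by_contra h'
      have := Submodule.length_strictMono (lt_of_le_not_ge hsoc h')
      rw [← hc, ← hr, h] at this
      exact lt_irrefl _ this
  have h2' : c ≤ cmType R := by
    have := Module.length_le_of_injective _ (Submodule.inclusion_injective hsoc)
    rw [← hc, ← hr] at this
    exact_mod_cast this
  rw [h1, h2]
  have hcount' : K.spanFinrank + a + c = n ^ 2 + b := by exact_mod_cast hcount
  zify at hcount'
  omega

variable {R S : Type u} [CommRing R] [IsLocalRing R] [CommRing S] [IsLocalRing S]

theorem IsBurchIdeal.not_le {I : Ideal S} (hI : IsBurchIdeal I) :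
    ¬ maximalIdeal S * I.colon (maximalIdeal S : Set S) ≤ maximalIdeal S * I := fun h =>
  hI (le_antisymm (Ideal.mul_mono_right fun _ hx =>
    Submodule.mem_colon.2 fun _ _ => Ideal.mul_mem_right _ _ hx) h)

theorem mem_colon_ker_iff {f : S →+* R} (hf : Function.Surjective f) (y : S) :
    y ∈ (RingHom.ker f).colon (maximalIdeal S : Set S) ↔
      f y ∈ (⊥ : Ideal R).colon (maximalIdeal R : Set R) := by
  have := IsLocalHom.of_surjective f hf
  rw [Submodule.mem_colon, Submodule.mem_colon]
  constructor
  · intro h a ha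
    obtain ⟨a, rfl⟩ := hf a
    have h1 := h a ((IsLocalRing.mem_maximalIdeal a).2 fun hu =>
      (IsLocalRing.mem_maximalIdeal _).1 ha (hu.map f))
    rw [RingHom.mem_ker, smul_eq_mul, map_mul] at h1
    simpa using h1
  · intro h a ha
    have h1 := h (f a) (map_maximalIdeal_le f (Ideal.mem_map_of_mem f ha))
    rw [RingHom.mem_ker, smul_eq_mul, map_mul]
    simpa using h1

/-- If `𝔪² F = 𝔪 K` and the socle is `𝔪²`, then no presenting ideal is Burch. -/
theorem not_isBurchIdeal_ker {f : S →+* R} (hf : Function.Surjective f)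
    {n : ℕ} {x : Fin n → R} (hx : Ideal.span (Set.range x) = maximalIdeal R)
    (hK : (maximalIdeal R ^ 2).piFin n ≤
      maximalIdeal R • LinearMap.ker (Fintype.linearCombination R x))
    (hsoc : (⊥ : Ideal R).colon (maximalIdeal R : Set R) ≤ maximalIdeal R ^ 2) :
    ¬ IsBurchIdeal (RingHom.ker f) := by
  intro hI
  apply hI.not_le
  have hloc := IsLocalHom.of_surjective f hf
  have hmap : (maximalIdeal S).map f = maximalIdeal R := map_maximalIdeal_of_surjective f hf
  have hfm : ∀ a, f a ∈ maximalIdeal R ↔ a ∈ maximalIdeal S := fun a => by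
    rw [IsLocalRing.mem_maximalIdeal, IsLocalRing.mem_maximalIdeal, mem_nonunits_iff,
      mem_nonunits_iff, isUnit_map_iff f a]
  choose X hX using fun i => hf (x i)
  have hXmem : ∀ i, X i ∈ maximalIdeal S := fun i => by
    rw [← hfm, hX, ← hx]; exact Ideal.subset_span ⟨i, rfl⟩
  let φ := Fintype.linearCombination S X
  have hφI : ∀ v : Fin n → S, (∀ i, v i ∈ RingHom.ker f) →
      φ v ∈ maximalIdeal S * RingHom.ker f := fun v hv => by
    rw [Fintype.linearCombination_apply]
    refine sum_mem fun i _ => ?_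
    rw [smul_eq_mul, mul_comm (v i)]
    exact Ideal.mul_mem_mul (hXmem i) (hv i)
  -- A lift of `rκ` differs from `ρκ'` by a vector over `I`, and `φ κ' ∈ I` because `κ` is a
  -- relation in `R`.
  have hlift : ∀ u ∈ maximalIdeal R • LinearMap.ker (Fintype.linearCombination R x),
      ∀ v : Fin n → S, (∀ i, f (v i) = u i) → φ v ∈ maximalIdeal S * RingHom.ker f := by
    intro u hu
    induction hu using Submodule.smul_induction_on' with
    | smul r hr κ hκ =>
      intro v hv
      obtain ⟨ρ, rfl⟩ := hf r
      choose κ' hκ' using fun i => hf (κ i)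
      have h1 : φ (v - ρ • κ') ∈ maximalIdeal S * RingHom.ker f := hφI _ fun i => by
        rw [RingHom.mem_ker]
        simp [hv, hκ']
      have h2 : φ κ' ∈ RingHom.ker f := by
        rw [LinearMap.mem_ker, Fintype.linearCombination_apply] at hκ
        rw [RingHom.mem_ker, Fintype.linearCombination_apply, map_sum, ← hκ]
        simp [hκ', hX]
      have h3 := add_mem h1 (Ideal.mul_mem_mul ((hfm ρ).1 hr) h2)
      rwa [map_sub, map_smul, smul_eq_mul, sub_add_cancel] at h3
    | add u₁ _ u₂ _ h₁ h₂ =>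
      intro v hv
      choose w hw using fun i => hf (u₁ i)
      have h3 := add_mem (h₁ w hw) (h₂ (v - w) fun i => by simp [hv, hw])
      rwa [← map_add, add_sub_cancel] at h3
  have hgen : maximalIdeal S ≤ Ideal.span (Set.range X) ⊔ RingHom.ker f := by
    intro a ha
    have h1 := (hfm a).2 ha
    rw [← hx, ← Set.image_univ] at h1
    obtain ⟨c, -, hc⟩ := Ideal.exists_sum_eq_of_mem_span_image h1
    choose c' hc' using fun i => hf (c i)
    rw [← sub_add_cancel a (∑ i, c' i * X i), add_comm]
    refine Submodule.add_mem_sup (sum_mem fun i _ =>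
      Ideal.mul_mem_left _ _ (Ideal.subset_span ⟨i, rfl⟩)) ?_
    rw [RingHom.mem_ker, map_sub, ← hc, map_sum]
    simp [hc', hX]
  -- Modulo `I`, the `X i` generate `𝔫`, and a vector over `𝔫²` reduces into `𝔪²F = 𝔪K`.
  have hsq : maximalIdeal S ^ 2 * maximalIdeal S ≤ maximalIdeal S * RingHom.ker f := by
    refine (Ideal.mul_mono_right hgen).trans ?_
    rw [Ideal.mul_sup]
    refine sup_le (Ideal.mul_le.2 fun a ha b hb => ?_)
      (Ideal.mul_mono_left (Ideal.pow_le_self two_ne_zero))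
    rw [← Set.image_univ] at hb
    obtain ⟨c, -, rfl⟩ := Ideal.exists_sum_eq_of_mem_span_image hb
    have h1 := hlift (fun i => f (a * c i)) (hK (Ideal.mem_piFin.2 fun i => by
      rw [← hmap, ← Ideal.map_pow]
      exact Ideal.mem_map_of_mem f (Ideal.mul_mem_right _ _ ha))) (fun i => a * c i)
      fun i => rfl
    rw [Fintype.linearCombination_apply] at h1
    simpa [Finset.mul_sum, mul_assoc] using h1
  have hcolon : (RingHom.ker f).colon (maximalIdeal S : Set S) ≤
      maximalIdeal S ^ 2 ⊔ RingHom.ker f := by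
    intro y hy
    have h1 := hsoc ((mem_colon_ker_iff hf y).1 hy)
    rw [← hmap, ← Ideal.map_pow] at h1
    obtain ⟨z, hz, hzy⟩ := (Ideal.mem_map_iff_of_surjective f hf).1 h1
    rw [← add_sub_cancel z y]
    exact Submodule.add_mem_sup hz (by rw [RingHom.mem_ker, map_sub, hzy, sub_self])
  refine (Ideal.mul_mono_right hcolon).trans ?_
  rw [Ideal.mul_sup, mul_comm (maximalIdeal S) (maximalIdeal S ^ 2)]
  exact sup_le hsq le_rfl

/-- By contraposition, `𝔫I = 𝔫(I : 𝔫)` must make both defects vanish. Thanks to `I ⊆ 𝔫²`, lifts of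
the minimal generators of `𝔪` are minimal generators of `𝔫`. -/
theorem isBurchIdeal_ker [IsNoetherianRing R] (hR : maximalIdeal R ^ 3 = ⊥) {S : Type u}
    [CommRing S] [IsRegularLocalRing S] {f : S →+* R} (hf : Function.Surjective f)
    (hker : RingHom.ker f ≤ maximalIdeal S ^ 2) (hS : maximalIdeal S ≠ ⊥)
    {n : ℕ} {x : Fin n → R} (hn : n = (maximalIdeal R).spanFinrank)
    (hx : Ideal.span (Set.range x) = maximalIdeal R)
    (h : ¬ ((maximalIdeal R ^ 2).piFin n ≤
        maximalIdeal R • LinearMap.ker (Fintype.linearCombination R x) ∧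
      (⊥ : Ideal R).colon (maximalIdeal R : Set R) ≤ maximalIdeal R ^ 2)) :
    IsBurchIdeal (RingHom.ker f) := by
  intro hI
  apply h
  have hloc := IsLocalHom.of_surjective f hf
  have hmap : (maximalIdeal S).map f = maximalIdeal R := map_maximalIdeal_of_surjective f hf
  have hfm : ∀ a, f a ∈ maximalIdeal R ↔ a ∈ maximalIdeal S := fun a => by
    rw [IsLocalRing.mem_maximalIdeal, IsLocalRing.mem_maximalIdeal, mem_nonunits_iff,
      mem_nonunits_iff, isUnit_map_iff f a]
  have h3 : maximalIdeal S ^ 3 ≤ RingHom.ker f := by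
    rw [← Ideal.map_eq_bot_iff_le_ker, Ideal.map_pow, hmap, hR]
  have hlift2 : ∀ r ∈ maximalIdeal R ^ 2, ∃ s ∈ maximalIdeal S ^ 2, f s = r := fun r hr => by
    rw [← hmap, ← Ideal.map_pow] at hr
    exact (Ideal.mem_map_iff_of_surjective f hf).1 hr
  choose X hX using fun i => hf (x i)
  have hXmem : ∀ i, X i ∈ maximalIdeal S := fun i => by
    rw [← hfm, hX, ← hx]; exact Ideal.subset_span ⟨i, rfl⟩
  have hgen : Ideal.span (Set.range X) = maximalIdeal S := by
    apply le_antisymm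
    · rw [Ideal.span_le]; rintro _ ⟨i, rfl⟩; exact hXmem i
    · apply Submodule.le_of_le_smul_of_le_jacobson_bot (I := maximalIdeal S)
        (IsNoetherian.noetherian _) (IsLocalRing.jacobson_eq_maximalIdeal ⊥ bot_ne_top).ge
      rw [smul_eq_mul, ← sq]
      intro a ha
      have h1 := (hfm a).2 ha
      rw [← hx, ← Set.image_univ] at h1
      obtain ⟨c, -, hc⟩ := Ideal.exists_sum_eq_of_mem_span_image h1
      choose c' hc' using fun i => hf (c i)
      rw [← sub_add_cancel a (∑ i, c' i * X i), add_comm]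
      refine Submodule.add_mem_sup (sum_mem fun i _ =>
        Ideal.mul_mem_left _ _ (Ideal.subset_span ⟨i, rfl⟩)) (hker ?_)
      rw [RingHom.mem_ker, map_sub, ← hc, map_sum]
      simp [hc', hX]
  have hd : n ≤ (maximalIdeal S).spanFinrank := by
    rw [hn, ← hmap]
    exact Ideal.spanFinrank_map_le_of_fg f (IsNoetherian.noetherian _)
  have hsoc : (⊥ : Ideal R).colon (maximalIdeal R : Set R) ≤ maximalIdeal R ^ 2 := by
    by_contra hsoc
    obtain ⟨y, hy, hy2⟩ := SetLike.not_le_iff_exists.1 hsoc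
    obtain ⟨y, rfl⟩ := hf y
    have hyI := (mem_colon_ker_iff hf y).2 hy
    have hy2' : y ∉ maximalIdeal S ^ 2 := fun h => hy2 (by
      rw [← hmap, ← Ideal.map_pow]; exact Ideal.mem_map_of_mem f h)
    -- A unit in `I : 𝔫` would give `𝔫 ⊆ I ⊆ 𝔫²`, hence `𝔫 = 0`.
    have hym : y ∈ maximalIdeal S := by
      by_contra hu
      have hu' : IsUnit y := by simpa using hu
      have h1 : maximalIdeal S ≤ maximalIdeal S ^ 2 := by
        intro a ha
        refine hker ((Ideal.unit_mul_mem_iff_mem _ hu').1 ?_)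
        exact Submodule.mem_colon.1 hyI a ha
      apply hS
      apply Submodule.eq_bot_of_le_smul_of_le_jacobson_bot (maximalIdeal S) _
        (IsNoetherian.noetherian _) _ (IsLocalRing.jacobson_eq_maximalIdeal ⊥ bot_ne_top).ge
      rwa [smul_eq_mul, ← sq]
    obtain ⟨Y, hY, i, rfl⟩ := exists_span_maximalIdeal_eq_of_notMem_sq hym hy2'
    -- The square lies in `𝔫(I : 𝔫) = 𝔫I ⊆ 𝔫³`. Modulo the other generators this becomes `(Y i - q)
    -- * Y i = 0` with `q ∈ 𝔫²`, in a domain where neither factor vanishes.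
    have h2 : Y i * Y i ∈ maximalIdeal S ^ 2 * maximalIdeal S := by
      have h4 : Y i * Y i ∈ maximalIdeal S * RingHom.ker f := by
        rw [hI]
        exact Ideal.mul_mem_mul hym hyI
      rw [mul_comm (maximalIdeal S ^ 2)]
      exact Ideal.mul_mono_right hker h4
    have hprime := IsRegularLocalRing.isPrime_span_image hY le_rfl {i}ᶜ
    have hnot : ∀ q ∈ maximalIdeal S ^ 2, Y i - q ∉ Ideal.span (Y '' {i}ᶜ) := fun q hq =>
      notMem_span_image hY le_rfl (by simp) hq
    have h5 : maximalIdeal S ^ 2 * maximalIdeal S ≤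
        maximalIdeal S ^ 2 * Ideal.span {Y i} ⊔ Ideal.span (Y '' {i}ᶜ) := by
      nth_rw 2 [← hY]
      rw [← Ideal.span_image_sup_span_image_compl Y {i}, Ideal.mul_sup, Set.image_singleton]
      exact sup_le_sup_left Ideal.mul_le_right _
    obtain ⟨z, hz, w, hw, hzw⟩ := Submodule.mem_sup.1 (h5 h2)
    obtain ⟨q, hq, rfl⟩ := Ideal.mem_mul_span_singleton.1 hz
    have h6 : (Y i - q) * Y i ∈ Ideal.span (Y '' {i}ᶜ) := by
      rw [sub_mul, ← hzw, add_sub_cancel_left]; exact hw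
    rcases hprime.mem_or_mem h6 with h7 | h7
    · exact hnot q hq h7
    · exact hnot 0 (zero_mem _) (by rwa [sub_zero])
  refine ⟨fun u hu => ?_, hsoc⟩
  choose v hv hvu using fun i => hlift2 (u i) (Ideal.mem_piFin.1 hu i)
  -- From `𝔫³ ⊆ I` follows `𝔫² ⊆ I : 𝔫`, so `𝔫³ ⊆ 𝔫(I : 𝔫) = 𝔫I`.
  have hcube : maximalIdeal S * maximalIdeal S ^ 2 ≤ Ideal.span (Set.range X) * RingHom.ker f := by
    rw [hgen, hI]
    refine Ideal.mul_mono_right fun y hy => Submodule.mem_colon.2 fun a ha => h3 ?_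
    rw [pow_succ]
    exact Ideal.mul_mem_mul hy ha
  have hsumX : ∀ b ∈ Ideal.span (Set.range X) * RingHom.ker f, ∃ w : Fin n → S,
      (∀ i, w i ∈ RingHom.ker f) ∧ Fintype.linearCombination S X w = b := by
    intro b hb
    induction hb using Submodule.mul_induction_on' with
    | mem_mul_mem a ha c hc =>
      rw [← Set.image_univ] at ha
      obtain ⟨t, -, rfl⟩ := Ideal.exists_sum_eq_of_mem_span_image ha
      refine ⟨fun i => t i * c, fun i => Ideal.mul_mem_left _ _ hc, ?_⟩
      simp only [Fintype.linearCombination_apply, smul_eq_mul, Finset.sum_mul]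
      exact Finset.sum_congr rfl fun i _ => by ring
    | add a _ c _ ha hc =>
      obtain ⟨w, hw, rfl⟩ := ha
      obtain ⟨w', hw', rfl⟩ := hc
      exact ⟨w + w', fun i => add_mem (hw i) (hw' i), map_add _ _ _⟩
  obtain ⟨w, hw, hwv⟩ := hsumX (Fintype.linearCombination S X v) (hcube (by
    rw [Fintype.linearCombination_apply]
    refine sum_mem fun i _ => ?_
    rw [smul_eq_mul, mul_comm (v i)]
    exact Ideal.mul_mem_mul (hXmem i) (hv i)))
  -- As `I ⊆ 𝔫²`, the relation `v - w` has entries in `𝔫²`; as `w` dies in `R`, it still lifts `u`.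
  have hmem := IsRegularLocalRing.mem_smul_ker_linearCombination hgen hd (v := v - w)
    (fun i => sub_mem (hv i) (hker (hw i))) (by rw [map_sub, hwv, sub_self])
  have hpush : ∀ t ∈ maximalIdeal S • LinearMap.ker (Fintype.linearCombination S X),
      (fun i => f (t i)) ∈ maximalIdeal R • LinearMap.ker (Fintype.linearCombination R x) := by
    intro t ht
    induction ht using Submodule.smul_induction_on' with
    | smul r hr κ hκ =>
      have h1 : (fun i => f ((r • κ) i)) = f r • fun i => f (κ i) := by
        ext i; simp
      rw [h1]
      refine Submodule.smul_mem_smul ((hfm r).2 hr) ?_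
      rw [LinearMap.mem_ker, Fintype.linearCombination_apply] at hκ ⊢
      have := congrArg f hκ
      rw [map_sum, map_zero] at this
      rw [← this]
      simp [hX]
    | add a _ c _ ha hc =>
      have h1 : (fun i => f ((a + c) i)) = (fun i => f (a i)) + fun i => f (c i) := by
        ext i; simp
      rw [h1]
      exact add_mem ha hc
  have hu' : u = fun i => f ((v - w) i) := by
    ext i
    rw [Pi.sub_apply, map_sub, hvu, (RingHom.mem_ker).1 (hw i), sub_zero]
  rw [hu']
  exact hpush _ hmem

/-- For an artinian local ring the Burch property only concerns presentations of the ring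
itself. -/
theorem isBurchRing_iff (R : Type u) [CommRing R] [IsLocalRing R] [IsNoetherianRing R] {n : ℕ}
    (hR : maximalIdeal R ^ n = ⊥) : IsBurchRing R ↔
      ∃ (S : Type u) (_ : CommRing S) (_ : IsRegularLocalRing S) (f : S →+* R),
        Function.Surjective f ∧ IsBurchIdeal (RingHom.ker f) := by
  have := isArtinianRing_of_maximalIdeal_pow_eq_bot hR
  -- `R` is its own completion, and an artinian ring has only the empty regular sequence.
  have : IsAdicComplete (maximalIdeal R) R := inferInstance
  let e : R ≃+* AdicCompletion (maximalIdeal R) R :=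
    (AdicCompletion.ofAlgEquiv (maximalIdeal R)).toRingEquiv
  have : IsArtinianRing (AdicCompletion (maximalIdeal R) R) := e.surjective.isArtinianRing
  have : Nontrivial (AdicCompletion (maximalIdeal R) R) := e.symm.toRingHom.domain_nontrivial
  constructor
  · rintro ⟨rs, -, hreg, -, S, _, _, I, hI, ⟨g⟩⟩
    rw [RingTheory.Sequence.eq_nil_of_isRegular_on_artinian hreg, Ideal.ofList_nil] at g
    let g' : S ⧸ I ≃+* R := g.symm.trans ((RingEquiv.quotientBot _).trans e.symm)
    refine ⟨S, ‹_›, ‹_›, g'.toRingHom.comp (Ideal.Quotient.mk I),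
      g'.surjective.comp Ideal.Quotient.mk_surjective, ?_⟩
    have : RingHom.ker (g'.toRingHom.comp (Ideal.Quotient.mk I)) = I := by
      rw [RingHom.ker_comp_of_injective _ g'.injective, Ideal.mk_ker]
    rwa [this]
  · rintro ⟨S, _, _, f, hf, hI⟩
    refine ⟨[], (localDepth_eq_zero R).symm, .nil _ _, fun y hy => ?_, S, ‹_›, ‹_›, _, hI, ?_⟩
    · exact absurd (RingTheory.Sequence.eq_nil_of_isRegular_on_artinian hy) (by simp)
    · rw [Ideal.ofList_nil]
      exact ⟨(RingEquiv.quotientBot _).trans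
        (e.symm.trans (RingHom.quotientKerEquivOfSurjective hf).symm)⟩

/-- A field is a Burch ring. -/
theorem exists_isBurchIdeal_of_isField (k : Type u) [CommRing k] (hk : IsField k) :
    ∃ (S : Type u) (_ : CommRing S) (_ : IsRegularLocalRing S) (f : S →+* k),
      Function.Surjective f ∧ IsBurchIdeal (RingHom.ker f) := by
  let := hk.toField
  have hker : RingHom.ker (PowerSeries.constantCoeff (R := k)) = maximalIdeal (PowerSeries k) :=
    PowerSeries.ker_coeff_eq_max_ideal
  refine ⟨PowerSeries k, inferInstance, inferInstance, PowerSeries.constantCoeff,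
    PowerSeries.constantCoeff_surj, ?_⟩
  rw [hker]
  -- Here `I = 𝔫 = (X)`, so `I : 𝔫` is the whole ring, and `𝔫² = 𝔫` would contradict Nakayama.
  intro h
  have htop : (maximalIdeal (PowerSeries k)).colon (maximalIdeal (PowerSeries k) : Set _) = ⊤ :=
    (Ideal.eq_top_iff_one _).2 (Submodule.mem_colon.2 fun s hs => by simpa using hs)
  rw [htop, Ideal.mul_top] at h
  apply IsDiscreteValuationRing.not_a_field (PowerSeries k)
  apply Submodule.eq_bot_of_le_smul_of_le_jacobson_bot (maximalIdeal (PowerSeries k)) _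
    (IsNoetherian.noetherian _) _ (IsLocalRing.jacobson_eq_maximalIdeal ⊥ bot_ne_top).ge
  exact h.ge

end Burch

theorem mainTheorem10 (R : Type u) [CommRing R] [IsNoetherianRing R] [IsLocalRing R]
    (hR : IsLocalRing.maximalIdeal R ^ 3 = ⊥) :
    IsBurchRing R ↔
      (betti R 2 (IsLocalRing.ResidueField R) : ℤ) > (edim R : ℤ) ^ 2 - (cmType R : ℤ) := by
  obtain ⟨n, x, hn, hx, hiff⟩ := betti_two_gt_iff R hR
  rw [hiff, isBurchRing_iff R hR]
  constructor
  · rintro ⟨S, _, _, f, hf, hI⟩ ⟨hK, hsoc⟩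
    exact not_isBurchIdeal_ker hf hx hK hsoc hI
  · intro h
    obtain ⟨S₀, _, _, f₀, hf₀⟩ := exists_regular_surjective R hR
    obtain ⟨S, _, _, f, hf, hker⟩ :=
      IsRegularLocalRing.exists_surjective_ker_le_sq _ S₀ f₀ hf₀ rfl
    by_cases hS : maximalIdeal S = ⊥
    · apply exists_isBurchIdeal_of_isField
      rw [isField_iff_maximalIdeal_eq, ← map_maximalIdeal_of_surjective f hf, hS, Ideal.map_bot]
    · exact ⟨S, ‹_›, ‹_›, f, hf, isBurchIdeal_ker hR hf hker hS hn hx h⟩
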